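/- Let $n,m,d\in\mathbb N$, let $A\in\mathbb R^{n\times n}$, $B\in\mathbb R^{n\times m}$ with $(A,B)$ controllable, and let $Q\in\mathbb R^{n\times n}$, $R\in\mathbb R^{m\times m}$ be symmetric positive definite. For $\gamma\in[0,1]$ let $P_\gamma$ be the positive definite solution of $$P_\gamma=\gamma A^{\top}P_\gamma A-\gamma^2A^{\top}P_\gamma B\,(R+\gamma B^{\top}P_\gamma B)^{-1}B^{\top}P_\gamma A+Q ,$$ and let $K_\gamma^*=-\gamma\,(R+\gamma B^{\top}P_\gamma B)^{-1}B^{\top}P_\gamma A$ be the $\gamma$-optimal linear feedback. Let $f_1,\dots,f_d:\mathbb R^n\to\mathbb R^m$ be globally Lipschitz and linearly independent functions such that for every $\gamma\in[0,1]$ the map $x\mapsto K_\gamma^*x$ lies in $\operatorname{Span}\{f_1,\dots,f_d\}$, and put $\pi_\theta(x)=\sum_{k=1}^d\theta_kf_k(x)$ for $\theta\in\mathbb R^d$. Let $\rho_0$ be a probability measure on $\mathbb R^n$ with full support and finite second moment, and let $$C_\gamma(\theta)=\mathbb E_{x_0\sim\rho_0}\sum_{t=0}^\infty\gamma^t\bigl(x_t^{\top}Qx_t+u_t^{\top}Ru_t\bigr),\qquad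 u_t=\pi_\theta(x_t),\quad x_{t+1}=Ax_t+Bu_t .$$ Then for every $\gamma\in(0,1)$ there is exactly one $\theta_\gamma^*\in\mathbb R^d$ with $\pi_{\theta_\gamma^*}(x)=K_\gamma^*x$ for all $x$, and there exist $\delta>0$ and $\lambda>0$ such that $C_\gamma$ is finite on $\{\theta:\|\theta-\theta_\gamma^*\|<\delta\}$ and the following holds for every gradient flow $\theta:[0,\infty)\to\mathbb R^d$ of $C_\gamma$, that is, every solution of $\theta'(s)=-\nabla C_\gamma(\theta(s))$ for all $s\ge 0$ ($C_\gamma$ being differentiable at the points $\theta(s)$), and also, since $C_\gamma$ need not be differentiable when the $f_k$ are only Lipschitz, every locally absolutely continuous curve with $-\theta'(s)\in\partial C_\gamma(\theta(s))$ for almost every $s\ge0$, where $\partial$ is the Clarke subdifferential. If $\|\theta(0)-\theta_\gamma^*\|<\delta$, then for all $s\ge 0$ the cost $C_\gamma(\theta(s))$ is finite and $$C_\gamma(\theta(s))-C_\gamma(\theta_\gamma^*)\le e^{-\lambda s}\bigl(C_\gamma(\theta(0))-C_\gamma(\theta_\gamma^*)\bigr),$$ and moreover $\lim_{s\to\infty}\theta(s)=\theta_\gamma^*$.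 -/

import Mathlib

open MeasureTheory Filter Topology Set
open scoped ENNReal Matrix

noncomputable section

namespace LQR

/-- `(A, B)` is controllable (Kalman): the columns of `B, A B, …, A^(n-1) B` span `ℝⁿ`. -/
def IsControllable {n m : ℕ} (A : Matrix (Fin n) (Fin n) ℝ) (B : Matrix (Fin n) (Fin m) ℝ) : Prop :=
  (⨆ k : Fin n, LinearMap.range (A ^ (k : ℕ) * B).mulVecLin) = ⊤

/-- `P` is a positive definite solution of the discounted discrete algebraic Riccati equation. -/
def IsRiccatiSolution {n m : ℕ} (A : Matrix (Fin n) (Fin n) ℝ) (B : Matrix (Fin n) (Fin m) ℝ)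
    (Q : Matrix (Fin n) (Fin n) ℝ) (R : Matrix (Fin m) (Fin m) ℝ) (γ : ℝ)
    (P : Matrix (Fin n) (Fin n) ℝ) : Prop :=
  P.PosDef ∧
    P = γ • (Aᵀ * P * A) - γ ^ 2 • (Aᵀ * P * B * (R + γ • (Bᵀ * P * B))⁻¹ * (Bᵀ * P * A)) + Q

open Classical in
/-- The matrix `P_γ`: the positive definite solution of the discounted Riccati equation
(and `0` if there were none). -/
def riccatiMatrix {n m : ℕ} (A : Matrix (Fin n) (Fin n) ℝ) (B : Matrix (Fin n) (Fin m) ℝ)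
    (Q : Matrix (Fin n) (Fin n) ℝ) (R : Matrix (Fin m) (Fin m) ℝ) (γ : ℝ) :
    Matrix (Fin n) (Fin n) ℝ :=
  if h : ∃ P, IsRiccatiSolution A B Q R γ P then h.choose else 0

/-- The `γ`-optimal gain `K_γ^* = -γ (R + γ Bᵀ P_γ B)⁻¹ Bᵀ P_γ A`. -/
def optimalGain {n m : ℕ} (A : Matrix (Fin n) (Fin n) ℝ) (B : Matrix (Fin n) (Fin m) ℝ)
    (Q : Matrix (Fin n) (Fin n) ℝ) (R : Matrix (Fin m) (Fin m) ℝ) (γ : ℝ) :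
    Matrix (Fin m) (Fin n) ℝ :=
  -(γ • ((R + γ • (Bᵀ * riccatiMatrix A B Q R γ * B))⁻¹ * (Bᵀ * riccatiMatrix A B Q R γ * A)))

/-- The policy `π_θ(x) = ∑ₖ θₖ fₖ(x)`. -/
def policy {n m d : ℕ} (f : Fin d → EuclideanSpace ℝ (Fin n) → EuclideanSpace ℝ (Fin m))
    (θ : EuclideanSpace ℝ (Fin d)) (x : EuclideanSpace ℝ (Fin n)) : EuclideanSpace ℝ (Fin m) :=
  ∑ k, θ k • f k x

/-- `θ` represents the `γ`-optimal policy: `π_θ(x) = K_γ^* x` for all `x`. -/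
def IsOptimalParam {n m d : ℕ} (A : Matrix (Fin n) (Fin n) ℝ) (B : Matrix (Fin n) (Fin m) ℝ)
    (Q : Matrix (Fin n) (Fin n) ℝ) (R : Matrix (Fin m) (Fin m) ℝ)
    (f : Fin d → EuclideanSpace ℝ (Fin n) → EuclideanSpace ℝ (Fin m)) (γ : ℝ)
    (θ : EuclideanSpace ℝ (Fin d)) : Prop :=
  ∀ x, policy f θ x = Matrix.toEuclideanLin (optimalGain A B Q R γ) x

/-- The state `x_t` at time `t` of `x_{t+1} = A x_t + B π(x_t)` started from `x₀`. -/
def state {n m : ℕ} (A : Matrix (Fin n) (Fin n) ℝ) (B : Matrix (Fin n) (Fin m) ℝ)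
    (π : EuclideanSpace ℝ (Fin n) → EuclideanSpace ℝ (Fin m)) (x₀ : EuclideanSpace ℝ (Fin n))
    (t : ℕ) : EuclideanSpace ℝ (Fin n) :=
  (fun x => Matrix.toEuclideanLin A x + Matrix.toEuclideanLin B (π x))^[t] x₀

/-- The one-step cost `xᵀ Q x + uᵀ R u`. -/
def stageCost {n m : ℕ} (Q : Matrix (Fin n) (Fin n) ℝ) (R : Matrix (Fin m) (Fin m) ℝ)
    (x : EuclideanSpace ℝ (Fin n)) (u : EuclideanSpace ℝ (Fin m)) : ℝ :=
  inner ℝ x (Matrix.toEuclideanLin Q x) + inner ℝ u (Matrix.toEuclideanLin R u)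

/-- The expected discounted cost `E_{x₀ ∼ ρ₀} ∑ₜ γᵗ (x_tᵀ Q x_t + u_tᵀ R u_t)` of the policy
`π_θ`, as an extended non-negative real. -/
def extCost {n m d : ℕ} (A : Matrix (Fin n) (Fin n) ℝ) (B : Matrix (Fin n) (Fin m) ℝ)
    (Q : Matrix (Fin n) (Fin n) ℝ) (R : Matrix (Fin m) (Fin m) ℝ)
    (f : Fin d → EuclideanSpace ℝ (Fin n) → EuclideanSpace ℝ (Fin m))
    (ρ₀ : Measure (EuclideanSpace ℝ (Fin n))) (γ : ℝ) (θ : EuclideanSpace ℝ (Fin d)) : ℝ≥0∞ :=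
  ∫⁻ x₀, ∑' t : ℕ, ENNReal.ofReal
    (γ ^ t * stageCost Q R (state A B (policy f θ) x₀ t)
      (policy f θ (state A B (policy f θ) x₀ t))) ∂ρ₀

/-- The cost `C_γ(θ)` as a real number (meaningful where `extCost` is finite). -/
def cost {n m d : ℕ} (A : Matrix (Fin n) (Fin n) ℝ) (B : Matrix (Fin n) (Fin m) ℝ)
    (Q : Matrix (Fin n) (Fin n) ℝ) (R : Matrix (Fin m) (Fin m) ℝ)
    (f : Fin d → EuclideanSpace ℝ (Fin n) → EuclideanSpace ℝ (Fin m))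
    (ρ₀ : Measure (EuclideanSpace ℝ (Fin n))) (γ : ℝ) (θ : EuclideanSpace ℝ (Fin d)) : ℝ :=
  (extCost A B Q R f ρ₀ γ θ).toReal

/-- `θ : [0, ∞) → E` is a (classical) gradient flow of `F`: for every `s ≥ 0` the function `F` is
differentiable at `θ(s)` and `θ'(s) = -∇F(θ(s))` (one-sided derivative at `s = 0`). -/
def IsGradientFlow {E : Type*} [NormedAddCommGroup E] [InnerProductSpace ℝ E] [CompleteSpace E]
    (F : E → ℝ) (θ : ℝ → E) : Prop :=
  ∀ s, 0 ≤ s → ∃ g : E, HasGradientAt F g (θ s) ∧ HasDerivWithinAt θ (-g) (Ici 0) s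

/-- Clarke's generalized directional derivative
`F°(x; v) = limsup_{y → x, t ↓ 0} (F(y + t v) - F(y)) / t`. -/
def clarkeDeriv {E : Type*} [NormedAddCommGroup E] [InnerProductSpace ℝ E]
    (F : E → ℝ) (x v : E) : EReal :=
  limsup (fun p : E × ℝ => (((F (p.1 + p.2 • v) - F p.1) / p.2 : ℝ) : EReal))
    (𝓝 x ×ˢ 𝓝[>] (0 : ℝ))

/-- Clarke's subdifferential `∂F(x) = {g | ⟨g, v⟩ ≤ F°(x; v) for all v}`. -/
def clarkeSubdifferential {E : Type*} [NormedAddCommGroup E] [InnerProductSpace ℝ E]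
    (F : E → ℝ) (x : E) : Set E :=
  {g | ∀ v : E, ((inner ℝ g v : ℝ) : EReal) ≤ clarkeDeriv F x v}

/-- `θ : [0, ∞) → E` is a gradient flow of `F` in the sense of Clarke (for `F` that need not be
differentiable): `θ` is absolutely continuous on every `[0, T]`, and `-θ'(s) ∈ ∂F(θ(s))` for almost
every `s ≥ 0`. -/
def IsClarkeGradientFlow {E : Type*} [NormedAddCommGroup E] [InnerProductSpace ℝ E]
    (F : E → ℝ) (θ : ℝ → E) : Prop :=
  (∀ T, 0 ≤ T → AbsolutelyContinuousOnInterval θ 0 T) ∧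
    ∀ᵐ s ∂(volume.restrict (Ici (0 : ℝ))), ∃ g ∈ clarkeSubdifferential F (θ s), HasDerivAt θ (-g) s

end LQR

end

/-! Let `V x = xᵀ P x` with `P` the Riccati matrix. Completing the square in the Bellman equation
(`bellman_eq`) gives, for the input `u = K x + w`, stage cost `+ γ V(x₊) = V(x) + ‖N w‖²`, where `N`
is a square root of `R + γ Bᵀ P B`. With `θ = θ* + φ` one has `w = π_φ(x)`, and telescoping along
the orbit (`extCost_add_eq`) yields `C(θ* + φ) = E V(x₀) + ‖T_φ φ‖²`. Here `T_ψ φ` is the sequence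
`γ^(t/2) N π_φ(x_t)`, taken along the closed loop of `θ* + ψ` and viewed in `L²(ρ₀ × count)`. It is
linear in `φ`.

The same identity with `w = 0` shows that `√γ (A + B K)` is a strict contraction in the norm `√V`.
Small Lipschitz perturbations keep the scaled orbits geometrically decaying and Lipschitz in the
parameter, so `ψ ↦ T_ψ` is Lipschitz near `0`. Moreover `T_0` is injective: its entry at time `0` is
`N π_φ(x₀)`, and `ρ₀` has full support. Hence `C` is a nondegenerate quadratic form around `θ*` up
to an error whose Lipschitz constant on the ball of radius `r` is `O(r²)`
(`isQuadraticNear_of_family`).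

This suffices without differentiability of `C`. A Clarke subgradient differs from the gradient of
the quadratic form by `O(r²)`, so near `θ*` a flow does not move away from `θ*`, and `C - C(θ*)`
decreases at a rate proportional to itself (`exists_forall_flow_exp_decay`). The quadratic lower
bound on `C - C(θ*)` then gives convergence of the flow. -/

namespace LQR

/-! ### Monotonicity for absolutely continuous functions. -/

section AbsolutelyContinuous

/-- The fundamental theorem of calculus for absolutely continuous functions. Asking only about
derivatives that exist spares later users from proving differentiability of `F ∘ θ`. -/
theorem le_of_absolutelyContinuous_of_deriv_nonpos {f : ℝ → ℝ} {a b : ℝ} (hab : a ≤ b)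
    (hf : AbsolutelyContinuousOnInterval f a b)
    (h : ∀ᵐ x, x ∈ Icc a b → ∀ D, HasDerivAt f D x → D ≤ 0) : f b ≤ f a := by
  have h1 := hf.integral_deriv_eq_sub
  have h2 : ∫ x in a..b, deriv f x ≤ 0 := by
    rw [intervalIntegral.integral_of_le hab]
    refine setIntegral_nonpos_of_ae_restrict ?_
    refine (ae_restrict_iff' measurableSet_Ioc).2 ?_
    filter_upwards [h] with x hx hxm
    by_cases hd : DifferentiableAt ℝ f x
    · exact hx (Ioc_subset_Icc_self hxm) _ hd.hasDerivAt
    -- Here `deriv` takes its default value `0`, which is harmless.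
    · simp [deriv_zero_of_not_differentiableAt hd]
  linarith

theorem absolutelyContinuousOnInterval_lipschitz_comp {X Y : Type*} [PseudoMetricSpace X]
    [PseudoMetricSpace Y] {f : ℝ → X} {G : X → Y} {S : Set X} {K : NNReal} {a b : ℝ}
    (hf : AbsolutelyContinuousOnInterval f a b) (hG : LipschitzOnWith K G S)
    (hfS : ∀ x ∈ uIcc a b, f x ∈ S) : AbsolutelyContinuousOnInterval (fun x => G (f x)) a b := by
  rw [absolutelyContinuousOnInterval_iff] at hf ⊢
  intro ε hε
  obtain ⟨δ, hδ, h⟩ := hf (ε / (K + 1)) (by positivity)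
  refine ⟨δ, hδ, fun I hI hlt => ?_⟩
  have h1 := h I hI hlt
  calc ∑ i ∈ Finset.range I.1, dist (G (f (I.2 i).1)) (G (f (I.2 i).2))
      ≤ ∑ i ∈ Finset.range I.1, K * dist (f (I.2 i).1) (f (I.2 i).2) := by
        refine Finset.sum_le_sum fun i hi => ?_
        have := hI.1 i hi
        exact hG.dist_le_mul _ (hfS _ this.1) _ (hfS _ this.2)
    _ = K * ∑ i ∈ Finset.range I.1, dist (f (I.2 i).1) (f (I.2 i).2) := by
        rw [Finset.mul_sum]
    _ ≤ (K + 1) * ∑ i ∈ Finset.range I.1, dist (f (I.2 i).1) (f (I.2 i).2) := by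
        exact mul_le_mul_of_nonneg_right (by linarith) (Finset.sum_nonneg fun _ _ => dist_nonneg)
    _ < (K + 1) * (ε / (K + 1)) := by gcongr
    _ = ε := by field_simp

end AbsolutelyContinuous

/-! ### Clarke subdifferential of a differentiable function. -/

section Clarke

variable {E : Type*} [NormedAddCommGroup E] [InnerProductSpace ℝ E]

/-- Freezing the base point at `y = x` restricts the limsup to a smaller filter, along which it is
the ordinary directional derivative. Classical flows can thus be handled together with Clarke flows.
-/
theorem mem_clarkeSubdifferential_of_hasGradientAt [CompleteSpace E] {F : E → ℝ} {g x : E}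
    (h : HasGradientAt F g x) : g ∈ clarkeSubdifferential F x := by
  intro v
  have h1 : HasDerivAt (fun t : ℝ => F (x + t • v)) (inner ℝ g v) 0 := by
    have h2 : HasDerivAt (fun t : ℝ => x + t • v) v 0 := by
      simpa using ((hasDerivAt_id (0 : ℝ)).smul_const v).const_add x
    have h3 := h.hasFDerivAt
    have h4 : HasFDerivAt F (InnerProductSpace.toDual ℝ E g) (x + (0 : ℝ) • v) := by simpa using h3
    have h5 := h4.comp_hasDerivAt (0 : ℝ) h2
    rw [InnerProductSpace.toDual_apply_apply] at h5
    exact h5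
  have h5 : Tendsto (fun t : ℝ => (F (x + t • v) - F x) / t) (𝓝[>] 0) (𝓝 (inner ℝ g v)) := by
    have := h1.tendsto_slope_zero_right
    simpa [div_eq_inv_mul] using this
  have h6 : Tendsto (fun t : ℝ => (((F (x + t • v) - F x) / t : ℝ) : EReal)) (𝓝[>] 0)
      (𝓝 ((inner ℝ g v : ℝ) : EReal)) :=
    (continuous_coe_real_ereal.tendsto _).comp h5
  rw [← h6.limsup_eq]
  have h7 : Tendsto (fun t : ℝ => (x, t)) (𝓝[>] 0) (𝓝 x ×ˢ 𝓝[>] (0 : ℝ)) :=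
    tendsto_const_nhds.prodMk tendsto_id
  unfold clarkeDeriv
  exact limsup_le_limsup_of_le (f := map (fun t : ℝ => (x, t)) (𝓝[>] 0)) h7
    (u := fun p : E × ℝ => (((F (p.1 + p.2 • v) - F p.1) / p.2 : ℝ) : EReal))

end Clarke

/-! ### First-order estimates for functions that are nearly quadratic. -/

section Flow

variable {E H : Type*} [NormedAddCommGroup E] [InnerProductSpace ℝ E]
  [NormedAddCommGroup H] [InnerProductSpace ℝ H]

/-- Near `x₀` the function `F` is the quadratic form `x ↦ ‖L (x - x₀)‖²` up to an error whose
Lipschitz constant on the ball of radius `r` is at most `C r²`. -/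
def IsQuadraticNear (F : E → ℝ) (L : E →L[ℝ] H) (x₀ : E) (δ C : ℝ) : Prop :=
  ∀ r, r ≤ δ → ∀ x y, ‖x - x₀‖ ≤ r → ‖y - x₀‖ ≤ r →
    |(F x - ‖L (x - x₀)‖ ^ 2) - (F y - ‖L (y - x₀)‖ ^ 2)| ≤ C * r ^ 2 * ‖x - y‖

/-- Derivatives at `x` need a neighbourhood of `x` inside the ball, so estimates are made for radii
`r > ‖x - x₀‖` and then `r ↓ ‖x - x₀‖`. -/
theorem le_add_of_forall_radius {a b C ρ δ w : ℝ} (hρ : ρ < δ)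
    (h : ∀ r, ρ < r → r ≤ δ → a ≤ b + C * r ^ 2 * w) : a ≤ b + C * ρ ^ 2 * w := by
  have h1 : Tendsto (fun r : ℝ => b + C * r ^ 2 * w) (𝓝[>] ρ) (𝓝 (b + C * ρ ^ 2 * w)) := by
    have : Continuous (fun r : ℝ => b + C * r ^ 2 * w) := by fun_prop
    exact (this.tendsto ρ).mono_left nhdsWithin_le_nhds
  refine ge_of_tendsto h1 ?_
  filter_upwards [Ioc_mem_nhdsGT hρ] with r hr using h r hr.1 hr.2

variable {F : E → ℝ} {L : E →L[ℝ] H} {x₀ : E} {δ C : ℝ}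

theorem norm_map_add_smul_sq (L : E →L[ℝ] H) (z v : E) (t : ℝ) :
    ‖L (z + t • v)‖ ^ 2 - ‖L z‖ ^ 2 = t * (2 * inner ℝ (L z) (L v) + t * ‖L v‖ ^ 2) := by
  rw [map_add, map_smul, norm_add_sq_real, inner_smul_right, norm_smul, mul_pow,
    Real.norm_eq_abs, sq_abs]
  ring

/-- The difference quotient splits into that of the quadratic form, which converges, and that of the
error, bounded by its Lipschitz constant. The slack `ε` absorbs the moving base point and the term
`t ‖L v‖²`. -/
theorem IsQuadraticNear.inner_le (hF : IsQuadraticNear F L x₀ δ C) {x g : E}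
    (hx : ‖x - x₀‖ < δ) (hg : g ∈ clarkeSubdifferential F x) (v : E) :
    inner ℝ g v ≤ 2 * inner ℝ (L (x - x₀)) (L v) + C * ‖x - x₀‖ ^ 2 * ‖v‖ := by
  refine le_add_of_forall_radius hx fun r hr hrδ => ?_
  refine le_of_forall_pos_le_add fun ε hε => ?_
  suffices hh : clarkeDeriv F x v ≤
      ((2 * inner ℝ (L (x - x₀)) (L v) + C * r ^ 2 * ‖v‖ + ε : ℝ) : EReal) from
    EReal.coe_le_coe_iff.1 ((hg v).trans hh)
  refine limsup_le_of_le (h := ?_)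
  have hc : Continuous (fun p : E × ℝ => p.1 + p.2 • v - x₀) := by fun_prop
  have hle : 𝓝 x ×ˢ 𝓝[>] (0 : ℝ) ≤ 𝓝 (x, (0 : ℝ)) := by
    rw [nhds_prod_eq]
    exact Filter.prod_mono le_rfl nhdsWithin_le_nhds
  have e1 : ∀ᶠ p : E × ℝ in 𝓝 x ×ˢ 𝓝[>] (0 : ℝ), ‖p.1 + p.2 • v - x₀‖ < r :=
    hle ((hc.norm.tendsto (x, (0 : ℝ))).eventually_lt_const (by simpa using hr))
  have e2 : ∀ᶠ p : E × ℝ in 𝓝 x ×ˢ 𝓝[>] (0 : ℝ), ‖p.1 - x₀‖ < r := by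
    have hc : Continuous (fun p : E × ℝ => ‖p.1 - x₀‖) := by fun_prop
    exact hle ((hc.tendsto (x, (0 : ℝ))).eventually_lt_const (by simpa using hr))
  have e3 : ∀ᶠ p : E × ℝ in 𝓝 x ×ˢ 𝓝[>] (0 : ℝ),
      2 * inner ℝ (L (p.1 - x₀)) (L v) + p.2 * ‖L v‖ ^ 2
        < 2 * inner ℝ (L (x - x₀)) (L v) + ε := by
    have hc : Continuous (fun p : E × ℝ =>
        2 * inner ℝ (L (p.1 - x₀)) (L v) + p.2 * ‖L v‖ ^ 2) := by fun_prop
    exact hle ((hc.tendsto (x, (0 : ℝ))).eventually_lt_const (by simpa using hε))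
  have e4 : ∀ᶠ p : E × ℝ in 𝓝 x ×ˢ 𝓝[>] (0 : ℝ), 0 < p.2 :=
    tendsto_snd.eventually self_mem_nhdsWithin
  filter_upwards [e1, e2, e3, e4] with p h1 h2 h3 h4
  refine EReal.coe_le_coe_iff.2 ?_
  rw [div_le_iff₀ h4]
  have h5 := (abs_le.1 (hF r hrδ _ _ h1.le h2.le)).2
  have h6 := norm_map_add_smul_sq L (p.1 - x₀) v p.2
  rw [sub_add_eq_add_sub] at h6
  have h7 : ‖p.1 + p.2 • v - p.1‖ = p.2 * ‖v‖ := by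
    rw [add_sub_cancel_left, norm_smul, Real.norm_of_nonneg h4.le]
  rw [h7] at h5
  nlinarith [mul_lt_mul_of_pos_left h3 h4]

theorem abs_le_of_hasDerivAt_of_lipschitz {e : ℝ → ℝ} {θ : ℝ → E} {D k s : ℝ} {w : E}
    (he : HasDerivAt e D s) (hθ : HasDerivAt θ w s)
    (h : ∀ᶠ s' in 𝓝 s, |e s' - e s| ≤ k * ‖θ s' - θ s‖) : |D| ≤ k * ‖w‖ := by
  have h1 := (hasDerivAt_iff_tendsto_slope.1 he).abs
  have h2 := (hasDerivAt_iff_tendsto_slope.1 hθ).norm.const_mul k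
  refine le_of_tendsto_of_tendsto h1 h2 ?_
  filter_upwards [h.filter_mono nhdsWithin_le_nhds] with s' hs'
  simp only [slope_def_module, norm_smul, smul_eq_mul, abs_mul, Real.norm_eq_abs]
  have := mul_le_mul_of_nonneg_left hs' (abs_nonneg (s' - s)⁻¹)
  linarith

/-- A substitute for the chain rule: the quadratic part is differentiated exactly, and the error
along the curve changes no faster than its Lipschitz constant times the speed of `θ`. -/
theorem IsQuadraticNear.deriv_le (hF : IsQuadraticNear F L x₀ δ C) {θ : ℝ → E} {s D : ℝ} {w : E}
    (hx : ‖θ s - x₀‖ < δ) (hD : HasDerivAt (fun s => F (θ s)) D s) (hθ : HasDerivAt θ w s) :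
    D ≤ 2 * inner ℝ (L (θ s - x₀)) (L w) + C * ‖θ s - x₀‖ ^ 2 * ‖w‖ := by
  refine le_add_of_forall_radius hx fun r hr hrδ => ?_
  have h1 : HasDerivAt (fun s => L (θ s - x₀)) (L w) s :=
    L.hasFDerivAt.comp_hasDerivAt s (hθ.sub_const x₀)
  have h2 := hD.sub h1.norm_sq
  have h3 : ∀ᶠ s' in 𝓝 s, ‖θ s' - x₀‖ < r :=
    (hθ.continuousAt.sub continuousAt_const).norm.eventually_lt_const hr
  have h4 := abs_le_of_hasDerivAt_of_lipschitz h2 hθ (k := C * r ^ 2) (by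
    filter_upwards [h3] with s' hs'
    exact hF r hrδ _ _ hs'.le hr.le)
  linarith [(abs_le.1 h4).2]

end Flow

/-! ### Exponential convergence of gradient flows at a nondegenerate minimum. -/

section Flow

variable {E H : Type*} [NormedAddCommGroup E] [InnerProductSpace ℝ E]
  [NormedAddCommGroup H] [InnerProductSpace ℝ H]
  {F : E → ℝ} {L : E →L[ℝ] H} {x₀ : E} {δ C c : ℝ}

theorem IsQuadraticNear.mono (hF : IsQuadraticNear F L x₀ δ C) {δ' : ℝ} (h : δ' ≤ δ) :
    IsQuadraticNear F L x₀ δ' C :=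
  fun r hr => hF r (hr.trans h)

theorem IsQuadraticNear.abs_sub_le (hF : IsQuadraticNear F L x₀ δ C) {x : E}
    (hx : ‖x - x₀‖ ≤ δ) : |F x - F x₀ - ‖L (x - x₀)‖ ^ 2| ≤ C * ‖x - x₀‖ ^ 3 := by
  have h := hF _ hx x x₀ le_rfl (by simp)
  simp only [sub_self, map_zero, norm_zero] at h
  calc _ = |F x - ‖L (x - x₀)‖ ^ 2 - (F x₀ - 0 ^ 2)| := by congr 1; ring
    _ ≤ _ := h
    _ = _ := by ring

/-- Needed to make `F ∘ θ` absolutely continuous. -/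
theorem IsQuadraticNear.lipschitzOnWith (hF : IsQuadraticNear F L x₀ δ C) (hδ : 0 ≤ δ)
    (hC : 0 ≤ C) :
    LipschitzOnWith (2 * ‖L‖ ^ 2 * δ + C * δ ^ 2).toNNReal F (Metric.closedBall x₀ δ) := by
  refine LipschitzOnWith.of_dist_le_mul fun x hx y hy => ?_
  rw [mem_closedBall_iff_norm] at hx hy
  rw [Real.coe_toNNReal _ (by positivity), Real.dist_eq, dist_eq_norm]
  have h1 := hF δ le_rfl x y hx hy
  have h2 : |‖L (x - x₀)‖ ^ 2 - ‖L (y - x₀)‖ ^ 2| ≤ 2 * ‖L‖ ^ 2 * δ * ‖x - y‖ := by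
    rw [sq_sub_sq, abs_mul]
    have h3 : |‖L (x - x₀)‖ - ‖L (y - x₀)‖| ≤ ‖L‖ * ‖x - y‖ := by
      refine (abs_norm_sub_norm_le _ _).trans ?_
      rw [← map_sub, sub_sub_sub_cancel_right]
      exact L.le_opNorm _
    have h4 : |‖L (x - x₀)‖ + ‖L (y - x₀)‖| ≤ 2 * ‖L‖ * δ := by
      rw [abs_of_nonneg (by positivity)]
      have := (L.le_opNorm (x - x₀)).trans (mul_le_mul_of_nonneg_left hx (norm_nonneg L))
      have := (L.le_opNorm (y - x₀)).trans (mul_le_mul_of_nonneg_left hy (norm_nonneg L))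
      linarith
    calc _ ≤ (2 * ‖L‖ * δ) * (‖L‖ * ‖x - y‖) := by gcongr
      _ = _ := by ring
  have h5 : F x - F y = (F x - ‖L (x - x₀)‖ ^ 2 - (F y - ‖L (y - x₀)‖ ^ 2))
      + (‖L (x - x₀)‖ ^ 2 - ‖L (y - x₀)‖ ^ 2) := by ring
  rw [h5]
  refine (abs_add_le _ _).trans ?_
  linarith

section Pointwise

variable (hc : 0 < c) (hC : 0 ≤ C) (hδC : 4 * C * δ ≤ c ^ 2)
  (hL : ∀ v, c * ‖v‖ ≤ ‖L v‖)

include hc hC hδC hL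

/-- Testing with `v = -φ` bounds `⟨g, φ⟩` below by `2 ‖L φ‖² - C ‖φ‖³`, and `4 C δ ≤ c²` absorbs the
cubic term. -/
theorem le_inner_of_forall_inner_le {φ g : E} (hφ : ‖φ‖ < δ)
    (hg : ∀ v, inner ℝ g v ≤ 2 * inner ℝ (L φ) (L v) + C * ‖φ‖ ^ 2 * ‖v‖) :
    c ^ 2 * ‖φ‖ ^ 2 ≤ inner ℝ g φ := by
  have h := hg (-φ)
  rw [inner_neg_right, map_neg, inner_neg_right, norm_neg, real_inner_self_eq_norm_sq] at h
  have h1 : (c * ‖φ‖) ^ 2 ≤ ‖L φ‖ ^ 2 := pow_le_pow_left₀ (by positivity) (hL φ) 2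
  have h2 : C * ‖φ‖ ≤ C * δ := by gcongr
  nlinarith [mul_le_mul_of_nonneg_right h2 (sq_nonneg ‖φ‖),
    mul_le_mul_of_nonneg_right hδC (sq_nonneg ‖φ‖), mul_nonneg (sq_nonneg c) (sq_nonneg ‖φ‖)]

/-- Testing with `v = g` bounds the left side by `-‖g‖² + 2 C ‖φ‖² ‖g‖`. Since `‖g‖ ≥ c² ‖φ‖`, this
is at most `-‖g‖² / 2 ≤ -c⁴ ‖φ‖² / 2`. -/
theorem descent_le {φ g : E} (hφ : ‖φ‖ < δ)
    (hg : ∀ v, inner ℝ g v ≤ 2 * inner ℝ (L φ) (L v) + C * ‖φ‖ ^ 2 * ‖v‖) :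
    2 * inner ℝ (L φ) (L (-g)) + C * ‖φ‖ ^ 2 * ‖-g‖ ≤ -(c ^ 4 / 2 * ‖φ‖ ^ 2) := by
  have h1 := le_inner_of_forall_inner_le hc hC hδC hL hφ hg
  have h2 := hg g
  rw [real_inner_self_eq_norm_sq] at h2
  rw [map_neg, inner_neg_right, norm_neg]
  have h3 : c ^ 2 * ‖φ‖ ≤ ‖g‖ := by
    rcases (norm_nonneg φ).eq_or_lt with h | h
    · rw [← h]; simp
    · refine le_of_mul_le_mul_right ?_ h
      nlinarith [real_inner_le_norm g φ]
  have h4 : 2 * C * ‖φ‖ ^ 2 * ‖g‖ ≤ ‖g‖ ^ 2 / 2 := by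
    have h5 : 4 * C * ‖φ‖ ≤ c ^ 2 := le_trans (by gcongr) hδC
    have h6 : (4 * C * ‖φ‖) * (‖φ‖ * ‖g‖) ≤ c ^ 2 * (‖φ‖ * ‖g‖) := by gcongr
    have h7 : c ^ 2 * ‖φ‖ * ‖g‖ ≤ ‖g‖ * ‖g‖ := by gcongr
    nlinarith
  have h8 : (c ^ 2 * ‖φ‖) ^ 2 ≤ ‖g‖ ^ 2 := by gcongr
  nlinarith

theorem IsQuadraticNear.le_sub (hF : IsQuadraticNear F L x₀ δ C) {x : E} (hx : ‖x - x₀‖ < δ) :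
    c ^ 2 / 2 * ‖x - x₀‖ ^ 2 ≤ F x - F x₀ := by
  have h := (abs_le.1 (hF.abs_sub_le hx.le)).1
  have h1 : (c * ‖x - x₀‖) ^ 2 ≤ ‖L (x - x₀)‖ ^ 2 := pow_le_pow_left₀ (by positivity) (hL _) 2
  have h2 : 4 * C * ‖x - x₀‖ ≤ c ^ 2 := le_trans (by gcongr) hδC
  nlinarith [mul_le_mul_of_nonneg_right h2 (sq_nonneg ‖x - x₀‖),
    mul_nonneg (sq_nonneg c) (sq_nonneg ‖x - x₀‖)]

omit hL hc in
theorem IsQuadraticNear.sub_le (hF : IsQuadraticNear F L x₀ δ C) {x : E} (hx : ‖x - x₀‖ < δ) :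
    F x - F x₀ ≤ (‖L‖ ^ 2 + c ^ 2) * ‖x - x₀‖ ^ 2 := by
  have h := (abs_le.1 (hF.abs_sub_le hx.le)).2
  have h1 : ‖L (x - x₀)‖ ^ 2 ≤ (‖L‖ * ‖x - x₀‖) ^ 2 :=
    pow_le_pow_left₀ (by positivity) (L.le_opNorm _) 2
  have h2 : 4 * C * ‖x - x₀‖ ≤ c ^ 2 := le_trans (by gcongr) hδC
  nlinarith [mul_le_mul_of_nonneg_right h2 (sq_nonneg ‖x - x₀‖),
    mul_nonneg (sq_nonneg c) (sq_nonneg ‖x - x₀‖)]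

end Pointwise

/-- The rate of exponential decay of a function that is quadratic near its minimum. -/
noncomputable def decayRate (L : E →L[ℝ] H) (c : ℝ) : ℝ := c ^ 4 / 2 / (‖L‖ ^ 2 + c ^ 2)

theorem decayRate_pos (hc : 0 < c) : 0 < decayRate L c := by
  unfold decayRate; positivity

theorem decayRate_mul_le (hc : 0 < c) (hC : 0 ≤ C) (hδC : 4 * C * δ ≤ c ^ 2)
    (hF : IsQuadraticNear F L x₀ δ C) {x : E} (hx : ‖x - x₀‖ < δ) :
    decayRate L c * (F x - F x₀) ≤ c ^ 4 / 2 * ‖x - x₀‖ ^ 2 := by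
  have h := mul_le_mul_of_nonneg_left (hF.sub_le hC hδC hx) (decayRate_pos (L := L) hc).le
  refine h.trans_eq ?_
  unfold decayRate
  field_simp

section Curve

variable (hc : 0 < c) (hC : 0 ≤ C) (hδ : 0 < δ) (hδC : 4 * C * δ ≤ c ^ 2)
  (hL : ∀ v, c * ‖v‖ ≤ ‖L v‖) (hF : IsQuadraticNear F L x₀ δ C)
  {θ : ℝ → E} {T : ℝ} (hT : 0 ≤ T) (hAC : AbsolutelyContinuousOnInterval θ 0 T)
  (hball : ∀ s ∈ Icc 0 T, ‖θ s - x₀‖ < δ)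
  (hae : ∀ᵐ s, s ∈ Icc 0 T → ∃ g ∈ clarkeSubdifferential F (θ s), HasDerivAt θ (-g) s)

include hc hC hδC hL hF hT hAC hball hae

/-- The derivative of `‖θ - x₀‖²` is `-2 ⟨g, θ - x₀⟩ ≤ 0` almost everywhere. -/
theorem norm_sub_le_of_clarke_flow : ‖θ T - x₀‖ ≤ ‖θ 0 - x₀‖ := by
  have h1 : AbsolutelyContinuousOnInterval (fun s => ‖θ s - x₀‖) 0 T := by
    refine absolutelyContinuousOnInterval_lipschitz_comp (K := 1) (S := univ)
      (G := fun x => ‖x - x₀‖) hAC ?_ (fun _ _ => mem_univ _)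
    refine LipschitzOnWith.of_dist_le_mul fun x _ y _ => ?_
    rw [NNReal.coe_one, one_mul, Real.dist_eq, dist_eq_norm]
    simpa using abs_norm_sub_norm_le (x - x₀) (y - x₀)
  have h2 := le_of_absolutelyContinuous_of_deriv_nonpos hT (h1.fun_mul h1) (by
    filter_upwards [hae] with s hs hsT D hD
    obtain ⟨g, hg, hθ⟩ := hs hsT
    have h3 := (hθ.sub_const x₀).norm_sq
    have h4 : D = 2 * inner ℝ (θ s - x₀) (-g) := by
      refine hD.unique ?_
      simpa only [← sq] using h3
    have h5 := le_inner_of_forall_inner_le hc hC hδC hL (hball s hsT)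
      (hF.inner_le (hball s hsT) hg)
    rw [h4, inner_neg_right, real_inner_comm]
    nlinarith [mul_nonneg (sq_nonneg c) (sq_nonneg ‖θ s - x₀‖)])
  simp only [← sq] at h2
  exact (sq_le_sq₀ (norm_nonneg _) (norm_nonneg _)).1 h2

include hδ in
theorem exp_decay_of_clarke_flow :
    F (θ T) - F x₀ ≤ Real.exp (-(T * decayRate L c)) * (F (θ 0) - F x₀) := by
  set lam := decayRate L c with hlam
  have h0 : AbsolutelyContinuousOnInterval (fun s => F (θ s)) 0 T := by
    refine absolutelyContinuousOnInterval_lipschitz_comp hAC (hF.lipschitzOnWith hδ.le hC) ?_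
    intro s hs
    rw [uIcc_of_le hT] at hs
    exact mem_closedBall_iff_norm.2 (hball s hs).le
  have h1 : AbsolutelyContinuousOnInterval (fun s => F (θ s) - F x₀) 0 T :=
    h0.fun_sub (LipschitzOnWith.absolutelyContinuousOnInterval
      (LipschitzWith.const (F x₀)).lipschitzOnWith)
  have h2 : AbsolutelyContinuousOnInterval (fun s => Real.exp (s * lam)) 0 T := by
    refine ContDiffOn.absolutelyContinuousOnInterval (ContDiff.contDiffOn ?_)
    fun_prop
  have hexp : ∀ k s : ℝ, HasDerivAt (fun s => Real.exp (s * k)) (Real.exp (s * k) * k) s := by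
    intro k s
    simpa using ((hasDerivAt_id s).mul_const k).exp
  -- The function `exp(λ s) (F(θ s) - F x₀)` is nonincreasing. Only its own derivative `D` is given,
  -- so that of `F ∘ θ` is recovered by multiplying by `exp(-λ s)`.
  have h3 := le_of_absolutelyContinuous_of_deriv_nonpos hT (h2.fun_mul h1) (by
    filter_upwards [hae] with s hs hsT D hD
    obtain ⟨g, hg, hθ⟩ := hs hsT
    have h4 := ((hexp (-lam) s).mul hD).add_const (F x₀)
    have h5 : HasDerivAt (fun s => F (θ s))
        (Real.exp (s * -lam) * -lam * (Real.exp (s * lam) * (F (θ s) - F x₀))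
          + Real.exp (s * -lam) * D) s := by
      refine h4.congr_of_eventuallyEq (Eventually.of_forall fun r => ?_)
      simp only [Pi.mul_apply]
      rw [← mul_assoc, ← Real.exp_add]
      simp
    have h6 := hF.deriv_le (hball s hsT) h5 hθ
    have h7 := descent_le hc hC hδC hL (hball s hsT) (hF.inner_le (hball s hsT) hg)
    have h8 := decayRate_mul_le hc hC hδC hF (hball s hsT)
    rw [← hlam] at h8
    have h9 : Real.exp (s * -lam) * Real.exp (s * lam) = 1 := by
      rw [← Real.exp_add]; simp
    have h10 : Real.exp (s * -lam) * D ≤ 0 := by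
      have h11 : Real.exp (s * -lam) * -lam * (Real.exp (s * lam) * (F (θ s) - F x₀))
          = -lam * (F (θ s) - F x₀) := by
        linear_combination (-lam * (F (θ s) - F x₀)) * h9
      linarith
    by_contra! h12
    exact absurd (mul_pos (Real.exp_pos (s * -lam)) h12) h10.not_gt)
  simp only [zero_mul, Real.exp_zero, one_mul] at h3
  rw [Real.exp_neg, inv_mul_eq_div, le_div_iff₀ (Real.exp_pos _), mul_comm]
  exact h3

end Curve

/-- A first-exit argument. Before the first time `T` with `u T ≥ δ` the hypothesis applies and gives
`u ≤ u 0`; the left limit at `T` then gives `u T ≤ u 0 < δ`. -/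
theorem forall_lt_of_forall_le_initial {u : ℝ → ℝ} (hu : ContinuousOn u (Ici 0))
    (h0 : u 0 < δ) (h : ∀ T, 0 ≤ T → (∀ s ∈ Icc 0 T, u s < δ) → u T ≤ u 0) :
    ∀ s, 0 ≤ s → u s < δ := by
  by_contra! hcon
  obtain ⟨s₁, hs₁, hδ⟩ := hcon
  have hK : IsCompact (Icc 0 s₁ ∩ u ⁻¹' Ici δ) := by
    refine isCompact_Icc.of_isClosed_subset ?_ inter_subset_left
    exact (hu.mono Icc_subset_Ici_self).preimage_isClosed_of_isClosed isClosed_Icc isClosed_Ici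
  obtain ⟨T, ⟨hT, hTδ⟩, hTmin⟩ := hK.exists_isLeast ⟨s₁, ⟨hs₁, le_rfl⟩, hδ⟩
  have hlt : ∀ s, 0 ≤ s → s < T → u s < δ := fun s h0s hsT => by
    by_contra! hs
    exact absurd (hTmin ⟨⟨h0s, hsT.le.trans hT.2⟩, hs⟩) hsT.not_ge
  have hTpos : 0 < T := by
    rcases hT.1.eq_or_lt with h | h
    · rw [← h] at hTδ
      exact absurd hTδ h0.not_ge
    · exact h
  have hle : u T ≤ u 0 := by
    have h1 : Tendsto u (𝓝[<] T) (𝓝 (u T)) := by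
      have := (hu T hT.1).mono (Ico_subset_Icc_self.trans Icc_subset_Ici_self : Ico 0 T ⊆ Ici 0)
      rwa [ContinuousWithinAt, nhdsWithin_Ico_eq_nhdsLT hTpos] at this
    refine le_of_tendsto h1 ?_
    filter_upwards [Ico_mem_nhdsLT hTpos] with s hs
    exact h s hs.1 fun r hr => hlt r hr.1 (hr.2.trans_lt hs.2)
  exact absurd (hle.trans_lt h0) (not_lt.2 hTδ)

theorem IsClarkeGradientFlow.continuousOn {θ : ℝ → E} (h : IsClarkeGradientFlow F θ) :
    ContinuousOn θ (Ici 0) := by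
  intro s hs
  have h1 := (h.1 (s + 1) (by linarith [mem_Ici.1 hs])).continuousOn
  rw [uIcc_of_le (by linarith [mem_Ici.1 hs])] at h1
  refine (h1 s ⟨hs, by linarith⟩).mono_of_mem_nhdsWithin ?_
  rw [← Ici_inter_Iic]
  exact inter_mem self_mem_nhdsWithin (mem_nhdsWithin_of_mem_nhds (Iic_mem_nhds (by linarith)))

theorem IsGradientFlow.continuousOn [CompleteSpace E] {θ : ℝ → E} (h : IsGradientFlow F θ) :
    ContinuousOn θ (Ici 0) := fun s hs => by
  obtain ⟨g, -, hg⟩ := h s hs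
  exact hg.continuousWithinAt

theorem IsGradientFlow.ae_mem_clarkeSubdifferential [CompleteSpace E] {θ : ℝ → E}
    (h : IsGradientFlow F θ) {T : ℝ} :
    ∀ᵐ s, s ∈ Icc 0 T → ∃ g ∈ clarkeSubdifferential F (θ s), HasDerivAt θ (-g) s := by
  -- At `s = 0` the derivative is only one-sided.
  have h0 : ∀ᵐ s : ℝ, s ≠ 0 := by simp [ae_iff, measure_singleton]
  filter_upwards [h0] with s hs hsT
  obtain ⟨g, hg, hθ⟩ := h s hsT.1
  exact ⟨g, mem_clarkeSubdifferential_of_hasGradientAt hg,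
    hθ.hasDerivAt (Ici_mem_nhds (lt_of_le_of_ne hsT.1 hs.symm))⟩

theorem IsClarkeGradientFlow.ae_mem_clarkeSubdifferential {θ : ℝ → E}
    (h : IsClarkeGradientFlow F θ) {T : ℝ} :
    ∀ᵐ s, s ∈ Icc 0 T → ∃ g ∈ clarkeSubdifferential F (θ s), HasDerivAt θ (-g) s := by
  filter_upwards [(ae_restrict_iff' measurableSet_Ici).1 h.2] with s hs hsT using hs hsT.1

/-- While the curve stays in the ball its velocity is a gradient there, hence bounded: testing
`inner_le` with the gradient itself bounds its norm. -/
theorem IsGradientFlow.absolutelyContinuousOnInterval [CompleteSpace E] {θ : ℝ → E} {T : ℝ}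
    (h : IsGradientFlow F θ) (hT : 0 ≤ T) (hF : IsQuadraticNear F L x₀ δ C) (hC : 0 ≤ C)
    (hball : ∀ s ∈ Icc 0 T, ‖θ s - x₀‖ < δ) : AbsolutelyContinuousOnInterval θ 0 T := by
  choose! g hg hθ using h
  have hδ : 0 < δ := (norm_nonneg _).trans_lt (hball 0 ⟨le_rfl, hT⟩)
  refine LipschitzOnWith.absolutelyContinuousOnInterval
    (K := (2 * ‖L‖ ^ 2 * δ + C * δ ^ 2).toNNReal) ?_
  rw [uIcc_of_le hT]
  refine (convex_Icc 0 T).lipschitzOnWith_of_nnnorm_hasDerivWithin_le (f' := fun s => -g s)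
    (fun s hs => (hθ s hs.1).mono Icc_subset_Ici_self) fun s hs => ?_
  rw [← NNReal.coe_le_coe, coe_nnnorm, Real.coe_toNNReal _ (by positivity), norm_neg]
  have h1 := hF.inner_le (hball s hs) (mem_clarkeSubdifferential_of_hasGradientAt (hg s hs.1)) (g s)
  rw [real_inner_self_eq_norm_sq] at h1
  rcases (norm_nonneg (g s)).eq_or_lt with h0 | h0
  · rw [← h0]; positivity
  refine le_of_mul_le_mul_right ?_ h0
  have h2 := real_inner_le_norm (L (θ s - x₀)) (L (g s))
  have h3 : ‖L (θ s - x₀)‖ * ‖L (g s)‖ ≤ (‖L‖ * δ) * (‖L‖ * ‖g s‖) := by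
    gcongr
    · exact (L.le_opNorm _).trans (by gcongr; exact (hball s hs).le)
    · exact L.le_opNorm _
  have h4 : C * ‖θ s - x₀‖ ^ 2 * ‖g s‖ ≤ C * δ ^ 2 * ‖g s‖ := by
    gcongr
    exact (hball s hs).le
  nlinarith

/-- Gradient flows, classical or in the sense of Clarke, that start close to a nondegenerate
minimum stay close to it and converge to it exponentially. -/
theorem exists_forall_flow_exp_decay [CompleteSpace E] (hc : 0 < c) (hC : 0 ≤ C) (hδ : 0 < δ)
    (hL : ∀ v, c * ‖v‖ ≤ ‖L v‖) (hF : IsQuadraticNear F L x₀ δ C) :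
    ∃ η > 0, η ≤ δ ∧ ∃ lam > 0, ∀ θ : ℝ → E,
      (IsGradientFlow F θ ∨ IsClarkeGradientFlow F θ) → ‖θ 0 - x₀‖ < η →
        (∀ s, 0 ≤ s → ‖θ s - x₀‖ < η ∧
          F (θ s) - F x₀ ≤ Real.exp (-(s * lam)) * (F (θ 0) - F x₀)) ∧
        Tendsto θ atTop (𝓝 x₀) := by
  -- The radius is shrunk until the quadratic form dominates the error; `+ 1` covers `C = 0`.
  obtain ⟨η, hη, hηδ, hηC⟩ : ∃ η > 0, η ≤ δ ∧ 4 * C * η ≤ c ^ 2 := by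
    refine ⟨min δ (c ^ 2 / (4 * C + 1)), by positivity, min_le_left _ _, ?_⟩
    calc 4 * C * min δ (c ^ 2 / (4 * C + 1)) ≤ (4 * C + 1) * (c ^ 2 / (4 * C + 1)) := by
          gcongr
          · linarith
          · exact min_le_right _ _
      _ = c ^ 2 := by field_simp
  have hF' := hF.mono hηδ
  refine ⟨η, hη, hηδ, decayRate L c, decayRate_pos hc, fun θ hflow h0 => ?_⟩
  have hcont : ContinuousOn θ (Ici 0) := hflow.elim (·.continuousOn) (·.continuousOn)
  have hae : ∀ T, ∀ᵐ s, s ∈ Icc 0 T →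
      ∃ g ∈ clarkeSubdifferential F (θ s), HasDerivAt θ (-g) s := fun T =>
    hflow.elim (·.ae_mem_clarkeSubdifferential) (·.ae_mem_clarkeSubdifferential)
  have hAC : ∀ T, 0 ≤ T → (∀ s ∈ Icc 0 T, ‖θ s - x₀‖ < η) →
      AbsolutelyContinuousOnInterval θ 0 T := fun T hT hball =>
    hflow.elim (fun h => h.absolutelyContinuousOnInterval hT hF' hC hball) (fun h => h.1 T hT)
  have hball : ∀ s, 0 ≤ s → ‖θ s - x₀‖ < η :=
    forall_lt_of_forall_le_initial (hcont.sub continuousOn_const).norm h0 fun T hT hb =>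
      norm_sub_le_of_clarke_flow hc hC hηC hL hF' hT (hAC T hT hb) hb (hae T)
  have hdecay : ∀ s, 0 ≤ s →
      F (θ s) - F x₀ ≤ Real.exp (-(s * decayRate L c)) * (F (θ 0) - F x₀) := fun s hs =>
    exp_decay_of_clarke_flow hc hC hη hηC hL hF' hs
      (hAC s hs fun r hr => hball r hr.1) (fun r hr => hball r hr.1) (hae s)
  refine ⟨fun s hs => ⟨hball s hs, hdecay s hs⟩, ?_⟩
  rw [tendsto_iff_norm_sub_tendsto_zero]
  have h1 : Tendsto (fun s => 2 / c ^ 2 *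
      (Real.exp (-(s * decayRate L c)) * (F (θ 0) - F x₀))) atTop (𝓝 0) := by
    have h2 : Tendsto (fun s : ℝ => Real.exp (-(s * decayRate L c))) atTop (𝓝 0) :=
      Real.tendsto_exp_neg_atTop_nhds_zero.comp
        (tendsto_id.atTop_mul_const (decayRate_pos hc))
    simpa using (h2.mul_const (F (θ 0) - F x₀)).const_mul (2 / c ^ 2)
  have h3 : Tendsto (fun s => ‖θ s - x₀‖ ^ 2) atTop (𝓝 0) := by
    refine squeeze_zero' (Eventually.of_forall fun _ => sq_nonneg _) ?_ h1
    filter_upwards [eventually_ge_atTop (0 : ℝ)] with s hs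
    have h4 := (hF'.le_sub hc hC hηC hL (hball s hs)).trans (hdecay s hs)
    rw [div_mul_eq_mul_div, le_div_iff₀ (by positivity)]
    linarith
  have h5 := h3.sqrt
  simpa [Real.sqrt_sq] using h5

end Flow

/-! ### Bellman equation and existence of the Riccati solution. -/

section Riccati

variable {n m : ℕ} (A : Matrix (Fin n) (Fin n) ℝ) (B : Matrix (Fin n) (Fin m) ℝ)
  (Q : Matrix (Fin n) (Fin n) ℝ) (R : Matrix (Fin m) (Fin m) ℝ) (γ : ℝ)

/-- The quadratic form `x ↦ xᵀ P x`. -/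
def quadForm {k : ℕ} (P : Matrix (Fin k) (Fin k) ℝ) (x : Fin k → ℝ) : ℝ := x ⬝ᵥ P *ᵥ x

/-- The right-hand side of the discounted Riccati equation. -/
noncomputable def riccatiStep (P : Matrix (Fin n) (Fin n) ℝ) : Matrix (Fin n) (Fin n) ℝ :=
  γ • (Aᵀ * P * A) - γ ^ 2 • (Aᵀ * P * B * (R + γ • (Bᵀ * P * B))⁻¹ * (Bᵀ * P * A)) + Q

/-- The matrix `R + γ Bᵀ P B`. -/
noncomputable def inputWeight (P : Matrix (Fin n) (Fin n) ℝ) : Matrix (Fin m) (Fin m) ℝ :=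
  R + γ • (Bᵀ * P * B)

/-- The greedy feedback gain `-γ (R + γ Bᵀ P B)⁻¹ Bᵀ P A`. -/
noncomputable def greedyGain (P : Matrix (Fin n) (Fin n) ℝ) : Matrix (Fin m) (Fin n) ℝ :=
  -(γ • ((R + γ • (Bᵀ * P * B))⁻¹ * (Bᵀ * P * A)))

theorem quadForm_add {k : ℕ} {P : Matrix (Fin k) (Fin k) ℝ} (hP : Pᵀ = P) (x y : Fin k → ℝ) :
    quadForm P (x + y) = quadForm P x + 2 * (x ⬝ᵥ P *ᵥ y) + quadForm P y := by
  have h : y ⬝ᵥ P *ᵥ x = x ⬝ᵥ P *ᵥ y := by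
    conv_lhs => rw [← hP, Matrix.dotProduct_transpose_mulVec]
  simp only [quadForm, Matrix.mulVec_add, add_dotProduct, dotProduct_add, h]
  ring

theorem quadForm_pos {k : ℕ} {P : Matrix (Fin k) (Fin k) ℝ} (hP : P.PosDef) {x : Fin k → ℝ}
    (hx : x ≠ 0) : 0 < quadForm P x := by
  simpa [quadForm] using hP.dotProduct_mulVec_pos hx

theorem quadForm_nonneg {k : ℕ} {P : Matrix (Fin k) (Fin k) ℝ} (hP : P.PosSemidef)
    (x : Fin k → ℝ) : 0 ≤ quadForm P x := by
  simpa [quadForm] using hP.dotProduct_mulVec_nonneg x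

theorem transpose_eq_of_posSemidef {k : ℕ} {P : Matrix (Fin k) (Fin k) ℝ} (hP : P.PosSemidef) :
    Pᵀ = P := by
  simpa [Matrix.IsHermitian] using hP.1

theorem inputWeight_posDef {R : Matrix (Fin m) (Fin m) ℝ} (hR : R.PosDef) {γ : ℝ} (hγ : 0 ≤ γ)
    {P : Matrix (Fin n) (Fin n) ℝ} (hP : P.PosSemidef) : (inputWeight B R γ P).PosDef := by
  refine hR.add_posSemidef (Matrix.PosSemidef.smul ?_ hγ)
  simpa using hP.conjTranspose_mul_mul_same B

variable {R γ}

/-- Completion of squares in the Bellman equation. -/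
theorem bellman_eq (hR : R.PosDef) (hγ : 0 ≤ γ) {P : Matrix (Fin n) (Fin n) ℝ}
    (hP : P.PosSemidef) (x : Fin n → ℝ) (u : Fin m → ℝ) :
    quadForm Q x + quadForm R u + γ * quadForm P (A *ᵥ x + B *ᵥ u) =
      quadForm (riccatiStep A B Q R γ P) x +
        quadForm (inputWeight B R γ P) (u - greedyGain A B R γ P *ᵥ x) := by
  have hM := inputWeight_posDef B hR hγ hP
  have hPt := transpose_eq_of_posSemidef hP
  have hMt := transpose_eq_of_posSemidef hM.posSemidef
  have hdet : IsUnit (inputWeight B R γ P).det := (Matrix.isUnit_iff_isUnit_det _).1 hM.isUnit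
  set M := inputWeight B R γ P with hMdef
  set z := M⁻¹ *ᵥ ((Bᵀ * P * A) *ᵥ x) with hz
  have hMz : M *ᵥ z = (Bᵀ * P * A) *ᵥ x := by
    rw [hz, Matrix.mulVec_mulVec, Matrix.mul_nonsing_inv _ hdet, Matrix.one_mulVec]
  have hK : u - greedyGain A B R γ P *ᵥ x = u + γ • z := by
    rw [greedyGain, Matrix.neg_mulVec, Matrix.smul_mulVec, ← Matrix.mulVec_mulVec, sub_neg_eq_add]
    rfl
  rw [hK, quadForm_add hPt, quadForm_add hMt]
  have e1 : quadForm P (A *ᵥ x) = x ⬝ᵥ (Aᵀ * P * A) *ᵥ x := by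
    rw [quadForm, ← Matrix.mulVec_mulVec, ← Matrix.mulVec_mulVec,
      Matrix.dotProduct_transpose_mulVec, dotProduct_comm]
  have e2 : quadForm P (B *ᵥ u) = u ⬝ᵥ (Bᵀ * P * B) *ᵥ u := by
    rw [quadForm, ← Matrix.mulVec_mulVec, ← Matrix.mulVec_mulVec,
      Matrix.dotProduct_transpose_mulVec, dotProduct_comm]
  have e3 : A *ᵥ x ⬝ᵥ P *ᵥ (B *ᵥ u) = u ⬝ᵥ (Bᵀ * P * A) *ᵥ x := by
    rw [← Matrix.mulVec_mulVec, ← Matrix.mulVec_mulVec, Matrix.dotProduct_transpose_mulVec,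
      ← hPt, Matrix.dotProduct_transpose_mulVec, hPt, dotProduct_comm]
  have e4 : quadForm M u = quadForm R u + γ * (u ⬝ᵥ (Bᵀ * P * B) *ᵥ u) := by
    simp only [quadForm, hMdef, inputWeight, Matrix.add_mulVec, Matrix.smul_mulVec, dotProduct_add,
      dotProduct_smul, smul_eq_mul]
  have e5 : u ⬝ᵥ M *ᵥ (γ • z) = γ * (u ⬝ᵥ (Bᵀ * P * A) *ᵥ x) := by
    rw [Matrix.mulVec_smul, hMz, dotProduct_smul, smul_eq_mul]
  have e6 : quadForm M (γ • z) = γ ^ 2 * (z ⬝ᵥ (Bᵀ * P * A) *ᵥ x) := by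
    rw [quadForm, Matrix.mulVec_smul, hMz, dotProduct_smul, smul_dotProduct, smul_eq_mul,
      smul_eq_mul]
    ring
  have e7 : quadForm (riccatiStep A B Q R γ P) x = γ * (x ⬝ᵥ (Aᵀ * P * A) *ᵥ x)
      - γ ^ 2 * (z ⬝ᵥ (Bᵀ * P * A) *ᵥ x) + quadForm Q x := by
    have e8 : x ⬝ᵥ (Aᵀ * P * B * M⁻¹ * (Bᵀ * P * A)) *ᵥ x = z ⬝ᵥ (Bᵀ * P * A) *ᵥ x := by
      have e9 : Aᵀ * P * B = (Bᵀ * P * A)ᵀ := by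
        simp [Matrix.transpose_mul, hPt, Matrix.mul_assoc]
      rw [e9, ← Matrix.mulVec_mulVec, ← Matrix.mulVec_mulVec, Matrix.dotProduct_transpose_mulVec]
    change x ⬝ᵥ (γ • (Aᵀ * P * A) - γ ^ 2 • (Aᵀ * P * B * M⁻¹ * (Bᵀ * P * A)) + Q) *ᵥ x = _
    simp only [quadForm, Matrix.add_mulVec, Matrix.sub_mulVec, Matrix.smul_mulVec, dotProduct_add,
      dotProduct_sub, dotProduct_smul, smul_eq_mul, e8]
  rw [e1, e2, e3, e4, e5, e6, e7]
  ring

variable {Q}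

theorem riccatiStep_posSemidef (hQ : Q.PosDef) (hR : R.PosDef) (hγ : 0 ≤ γ)
    {P : Matrix (Fin n) (Fin n) ℝ} (hP : P.PosSemidef) :
    (riccatiStep A B Q R γ P).PosSemidef := by
  have hPt := transpose_eq_of_posSemidef hP
  have hQt := transpose_eq_of_posSemidef hQ.posSemidef
  have hMt := transpose_eq_of_posSemidef (inputWeight_posDef B hR hγ hP).posSemidef
  have hMt' : (R + γ • (Bᵀ * P * B))ᵀ = R + γ • (Bᵀ * P * B) := hMt
  refine .of_dotProduct_mulVec_nonneg ?_ fun x => ?_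
  · rw [Matrix.IsHermitian, Matrix.conjTranspose_eq_transpose_of_trivial, riccatiStep]
    rw [Matrix.transpose_add, Matrix.transpose_sub, Matrix.transpose_smul, Matrix.transpose_smul,
      Matrix.transpose_mul _ (Bᵀ * P * A), Matrix.transpose_mul _ (R + γ • (Bᵀ * P * B))⁻¹,
      Matrix.transpose_nonsing_inv, hMt', hQt]
    simp [Matrix.transpose_mul, hPt, Matrix.mul_assoc]
  · have h := bellman_eq A B Q hR hγ hP x (greedyGain A B R γ P *ᵥ x)
    rw [sub_self] at h
    have h0 : quadForm (inputWeight B R γ P) 0 = 0 := by simp [quadForm]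
    rw [h0, add_zero] at h
    rw [star_trivial]
    change 0 ≤ quadForm _ x
    rw [← h]
    have := quadForm_nonneg hQ.posSemidef x
    have := quadForm_nonneg hR.posSemidef (greedyGain A B R γ P *ᵥ x)
    have := quadForm_nonneg hP (A *ᵥ x + B *ᵥ greedyGain A B R γ P *ᵥ x)
    positivity

/-- One Riccati step is the minimum over `u` of the one-step Bellman cost, attained at the greedy
gain (`quadForm_riccatiStep_eq`). -/
theorem quadForm_riccatiStep_le (hR : R.PosDef) (hγ : 0 ≤ γ)
    {P : Matrix (Fin n) (Fin n) ℝ} (hP : P.PosSemidef) (x : Fin n → ℝ) (u : Fin m → ℝ) :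
    quadForm (riccatiStep A B Q R γ P) x ≤
      quadForm Q x + quadForm R u + γ * quadForm P (A *ᵥ x + B *ᵥ u) := by
  rw [bellman_eq A B Q hR hγ hP]
  linarith [quadForm_nonneg (inputWeight_posDef B hR hγ hP).posSemidef
    (u - greedyGain A B R γ P *ᵥ x)]

theorem quadForm_riccatiStep_eq (hR : R.PosDef) (hγ : 0 ≤ γ)
    {P : Matrix (Fin n) (Fin n) ℝ} (hP : P.PosSemidef) (x : Fin n → ℝ) :
    quadForm (riccatiStep A B Q R γ P) x =
      quadForm Q x + quadForm R (greedyGain A B R γ P *ᵥ x) +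
        γ * quadForm P (A *ᵥ x + B *ᵥ (greedyGain A B R γ P *ᵥ x)) := by
  rw [bellman_eq A B Q hR hγ hP]
  simp [quadForm]

/-- The greedy input for `P'` is admissible, though not optimal, for `P`. -/
theorem quadForm_riccatiStep_mono (hR : R.PosDef) (hγ : 0 ≤ γ)
    {P P' : Matrix (Fin n) (Fin n) ℝ} (hP : P.PosSemidef) (hP' : P'.PosSemidef)
    (h : ∀ x, quadForm P x ≤ quadForm P' x) (x : Fin n → ℝ) :
    quadForm (riccatiStep A B Q R γ P) x ≤ quadForm (riccatiStep A B Q R γ P') x := by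
  rw [quadForm_riccatiStep_eq A B hR hγ hP']
  refine (quadForm_riccatiStep_le A B hR hγ hP x (greedyGain A B R γ P' *ᵥ x)).trans ?_
  gcongr
  exact h _

variable (Q R γ) in
/-- The value iteration started from `0`. -/
noncomputable def valueIter (k : ℕ) : Matrix (Fin n) (Fin n) ℝ := (riccatiStep A B Q R γ)^[k] 0

theorem valueIter_succ (k : ℕ) :
    valueIter A B Q R γ (k + 1) = riccatiStep A B Q R γ (valueIter A B Q R γ k) :=
  Function.iterate_succ_apply' _ _ _

theorem valueIter_posSemidef (hQ : Q.PosDef) (hR : R.PosDef) (hγ : 0 ≤ γ) (k : ℕ) :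
    (valueIter A B Q R γ k).PosSemidef := by
  induction k with
  | zero => exact Matrix.PosSemidef.zero
  | succ k ih =>
    rw [valueIter_succ]
    exact riccatiStep_posSemidef A B hQ hR hγ ih

theorem quadForm_valueIter_mono (hQ : Q.PosDef) (hR : R.PosDef) (hγ : 0 ≤ γ) (x : Fin n → ℝ) :
    Monotone fun k => quadForm (valueIter A B Q R γ k) x := by
  have h := valueIter_posSemidef A B hQ hR hγ
  refine monotone_nat_of_le_succ fun k => ?_
  induction k generalizing x with
  | zero =>
    have h0 : quadForm (valueIter A B Q R γ 0) x = 0 := by simp [valueIter, quadForm]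
    rw [h0]
    exact quadForm_nonneg (h 1) x
  | succ k ih =>
    rw [valueIter_succ A B k, valueIter_succ A B (k + 1)]
    exact quadForm_riccatiStep_mono A B hR hγ (h k) (h (k + 1)) ih x

/-- Each value iterate is at most the cost of the inputs that steer `x` to `0` in `k` steps, since
nothing is paid after reaching `0`. -/
theorem bddAbove_quadForm_valueIter_of_steer (hQ : Q.PosDef) (hR : R.PosDef) (hγ : 0 ≤ γ)
    (k : ℕ) (w : ℕ → Fin m → ℝ) (x : Fin n → ℝ)
    (h : A ^ k *ᵥ x + ∑ i ∈ Finset.range k, (A ^ i * B) *ᵥ w i = 0) :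
    BddAbove (Set.range fun j => quadForm (valueIter A B Q R γ j) x) := by
  induction k generalizing x with
  | zero =>
    have hx : x = 0 := by simpa using h
    refine ⟨0, ?_⟩
    rintro _ ⟨j, rfl⟩
    simp [hx, quadForm]
  | succ k ih =>
    -- The inputs are indexed backwards: `w k` carries the factor `A ^ k`, so it is applied first.
    obtain ⟨c, hc⟩ := ih (A *ᵥ x + B *ᵥ w k) (by
      rw [Finset.sum_range_succ] at h
      rw [Matrix.mulVec_add, Matrix.mulVec_mulVec, Matrix.mulVec_mulVec, ← pow_succ, add_assoc,
        add_comm (_ *ᵥ w k)]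
      exact h)
    refine ⟨max 0 (quadForm Q x + quadForm R (w k) + γ * c), ?_⟩
    rintro _ ⟨j, rfl⟩
    cases j with
    | zero => simp [valueIter, quadForm]
    | succ j =>
      refine le_max_of_le_right ?_
      simp only [valueIter_succ]
      refine (quadForm_riccatiStep_le A B hR hγ (valueIter_posSemidef A B hQ hR hγ j) x
        (w k)).trans ?_
      have := hc ⟨j, rfl⟩
      gcongr

variable {A B} in
theorem IsControllable.exists_steer (hAB : IsControllable A B) (x : Fin n → ℝ) :
    ∃ w : ℕ → Fin m → ℝ, ∑ i ∈ Finset.range n, (A ^ i * B) *ᵥ w i = x := by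
  have hx : x ∈ ⨆ k : Fin n, LinearMap.range (A ^ (k : ℕ) * B).mulVecLin := by
    rw [hAB]; trivial
  induction hx using Submodule.iSup_induction' with
  | mem k x hx =>
    obtain ⟨v, rfl⟩ := hx
    refine ⟨fun i => if i = k then v else 0, ?_⟩
    rw [Finset.sum_eq_single (k : ℕ)]
    · simp
    · intro i _ hi
      simp [hi]
    · intro h
      exact absurd (Finset.mem_range.2 k.2) h
  | zero => exact ⟨0, by simp⟩
  | add x y _ _ hx hy =>
    obtain ⟨w, rfl⟩ := hx
    obtain ⟨w', rfl⟩ := hy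
    exact ⟨w + w', by simp [Matrix.mulVec_add, Finset.sum_add_distrib]⟩

/-- Polarization, which turns convergence of the quadratic forms into convergence of the entries. -/
theorem apply_eq_quadForm {k : ℕ} {P : Matrix (Fin k) (Fin k) ℝ} (hP : Pᵀ = P) (i j : Fin k) :
    P i j = (quadForm P (Pi.single i 1 + Pi.single j 1) - quadForm P (Pi.single i 1)
      - quadForm P (Pi.single j 1)) / 2 := by
  rw [quadForm_add hP]
  simp
  ring

theorem continuous_quadForm {k : ℕ} (x : Fin k → ℝ) :
    Continuous fun P : Matrix (Fin k) (Fin k) ℝ => quadForm P x := by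
  unfold quadForm
  fun_prop

theorem continuousAt_riccatiStep (hR : R.PosDef) (hγ : 0 ≤ γ) {P : Matrix (Fin n) (Fin n) ℝ}
    (hP : P.PosSemidef) : ContinuousAt (riccatiStep A B Q R γ) P := by
  have hdet : (inputWeight B R γ P).det ≠ 0 := (inputWeight_posDef B hR hγ hP).det_pos.ne'
  have h1 : ContinuousAt (fun P : Matrix (Fin n) (Fin n) ℝ => (R + γ • (Bᵀ * P * B))⁻¹) P := by
    have h2 : ContinuousAt (fun P : Matrix (Fin n) (Fin n) ℝ => R + γ • (Bᵀ * P * B)) P := by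
      fun_prop
    refine ContinuousAt.comp (g := fun M : Matrix (Fin m) (Fin m) ℝ => M⁻¹)
      (f := fun P : Matrix (Fin n) (Fin n) ℝ => R + γ • (Bᵀ * P * B)) ?_ h2
    refine continuousAt_matrix_inv _ ?_
    rw [Ring.inverse_eq_inv']
    exact continuousAt_inv₀ hdet
  unfold riccatiStep
  fun_prop

variable {A B} in
-- Value iteration from `0` is monotone, and bounded because controllability steers every state to
-- `0` in `n` steps. Its limit is a fixed point by continuity and is positive definite because it
-- dominates `Q`.
theorem exists_isRiccatiSolution (hQ : Q.PosDef) (hR : R.PosDef) (hγ : 0 ≤ γ)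
    (hAB : IsControllable A B) : ∃ P, IsRiccatiSolution A B Q R γ P := by
  have hsemi := valueIter_posSemidef A B hQ hR hγ
  have hconv : ∀ x, ∃ l, Tendsto (fun k => quadForm (valueIter A B Q R γ k) x) atTop (𝓝 l) := by
    intro x
    obtain ⟨w, hw⟩ := hAB.exists_steer (-(A ^ n *ᵥ x))
    exact ⟨_, tendsto_atTop_ciSup (quadForm_valueIter_mono A B hQ hR hγ x)
      (bddAbove_quadForm_valueIter_of_steer A B hQ hR hγ n w x (by rw [hw]; simp))⟩
  choose l hl using hconv
  let P : Matrix (Fin n) (Fin n) ℝ := Matrix.of fun i j =>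
    (l (Pi.single i 1 + Pi.single j 1) - l (Pi.single i 1) - l (Pi.single j 1)) / 2
  have hP : Tendsto (valueIter A B Q R γ) atTop (𝓝 P) := by
    refine tendsto_pi_nhds.2 fun i => tendsto_pi_nhds.2 fun j => ?_
    refine (((hl _).sub (hl _)).sub (hl _)).div_const 2 |>.congr fun k => ?_
    exact (apply_eq_quadForm (transpose_eq_of_posSemidef (hsemi k)) i j).symm
  have hPq : ∀ x, Tendsto (fun k => quadForm (valueIter A B Q R γ k) x) atTop
      (𝓝 (quadForm P x)) := fun x => ((continuous_quadForm x).tendsto P).comp hP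
  have hPt : Pᵀ = P := by
    have h1 : Continuous fun P : Matrix (Fin n) (Fin n) ℝ => Pᵀ := by fun_prop
    refine tendsto_nhds_unique ((h1.tendsto P).comp hP) (hP.congr fun k => ?_)
    exact (transpose_eq_of_posSemidef (hsemi k)).symm
  have hherm : P.IsHermitian := by
    rw [Matrix.IsHermitian, Matrix.conjTranspose_eq_transpose_of_trivial, hPt]
  have hPsemi : P.PosSemidef := by
    refine .of_dotProduct_mulVec_nonneg hherm fun x => ?_
    rw [star_trivial]
    exact ge_of_tendsto' (hPq x) fun k => quadForm_nonneg (hsemi k) x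
  have hfix : P = riccatiStep A B Q R γ P := by
    refine tendsto_nhds_unique ((tendsto_add_atTop_iff_nat 1).2 hP) ?_
    simp only [valueIter_succ]
    exact (continuousAt_riccatiStep A B hR hγ hPsemi).tendsto.comp hP
  refine ⟨P, .of_dotProduct_mulVec_pos hherm fun x hx => ?_, hfix⟩
  rw [star_trivial]
  change 0 < quadForm P x
  rw [hfix, quadForm_riccatiStep_eq A B hR hγ hPsemi]
  have := quadForm_pos hQ hx
  have := quadForm_nonneg hR.posSemidef (greedyGain A B R γ P *ᵥ x)
  have := quadForm_nonneg hPsemi (A *ᵥ x + B *ᵥ greedyGain A B R γ P *ᵥ x)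
  positivity

variable {A B} in
-- Uniqueness of the solution plays no role: only the fixed-point equation and positive definiteness
-- of the chosen one are used.
theorem riccatiMatrix_spec (hQ : Q.PosDef) (hR : R.PosDef) (hγ : 0 ≤ γ)
    (hAB : IsControllable A B) : IsRiccatiSolution A B Q R γ (riccatiMatrix A B Q R γ) := by
  have h := exists_isRiccatiSolution hQ hR hγ hAB
  rw [riccatiMatrix, dif_pos h]
  exact h.choose_spec

end Riccati

/-! ### Square roots of positive definite forms. -/

section Factorization

open scoped MatrixOrder in
/-- A positive definite quadratic form is the square of the norm of an injective linear map. -/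
theorem exists_norm_sq_eq_quadForm {k : ℕ} {P : Matrix (Fin k) (Fin k) ℝ} (hP : P.PosDef) :
    ∃ S : EuclideanSpace ℝ (Fin k) →L[ℝ] EuclideanSpace ℝ (Fin k),
      (∀ x, ‖S x‖ ^ 2 = quadForm P x.ofLp) ∧ ∃ κ > 0, ∀ x, ‖x‖ ≤ κ * ‖S x‖ := by
  have h1 : CFC.sqrt P * CFC.sqrt P = P := CFC.sqrt_mul_sqrt_self P hP.posSemidef.nonneg
  have h2 : (CFC.sqrt P)ᵀ = CFC.sqrt P :=
    transpose_eq_of_posSemidef (Matrix.nonneg_iff_posSemidef.1 (CFC.sqrt_nonneg P))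
  let S : EuclideanSpace ℝ (Fin k) →L[ℝ] EuclideanSpace ℝ (Fin k) :=
    (Matrix.toEuclideanLin (CFC.sqrt P)).toContinuousLinearMap
  have hS : ∀ x, ‖S x‖ ^ 2 = quadForm P x.ofLp := by
    intro x
    rw [← real_inner_self_eq_norm_sq]
    change (CFC.sqrt P *ᵥ x.ofLp) ⬝ᵥ star (CFC.sqrt P *ᵥ x.ofLp) = _
    rw [star_trivial, quadForm]
    nth_rw 3 [← h1]
    rw [← Matrix.mulVec_mulVec]
    nth_rw 3 [← h2]
    rw [Matrix.dotProduct_transpose_mulVec]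
  have hker : LinearMap.ker (S : EuclideanSpace ℝ (Fin k) →ₗ[ℝ] EuclideanSpace ℝ (Fin k)) = ⊥ := by
    refine LinearMap.ker_eq_bot'.2 fun x hx => ?_
    by_contra hne
    have h3 := hS x
    have h4 : S x = 0 := hx
    rw [h4, norm_zero] at h3
    have h5 : x.ofLp ≠ 0 := fun h => hne (by ext i; simp [h])
    have := quadForm_pos hP h5
    norm_num at h3
    linarith
  obtain ⟨K, hK, hanti⟩ := LinearMap.exists_antilipschitzWith _ hker
  refine ⟨S, hS, K, by exact_mod_cast hK, fun x => ?_⟩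
  have := hanti.le_mul_dist x 0
  simpa using this

theorem inner_toEuclideanLin {k : ℕ} (P : Matrix (Fin k) (Fin k) ℝ)
    (x : EuclideanSpace ℝ (Fin k)) : inner ℝ x (Matrix.toEuclideanLin P x) = quadForm P x.ofLp := by
  change (P *ᵥ x.ofLp) ⬝ᵥ star x.ofLp = _
  rw [star_trivial, dotProduct_comm, quadForm]

end Factorization

/-! ### Linearity and Lipschitz bounds of the policies. -/

section Policy

variable {n m d : ℕ} (f : Fin d → EuclideanSpace ℝ (Fin n) → EuclideanSpace ℝ (Fin m))

theorem policy_add (φ ψ : EuclideanSpace ℝ (Fin d)) (x : EuclideanSpace ℝ (Fin n)) :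
    policy f (φ + ψ) x = policy f φ x + policy f ψ x := by
  simp [policy, add_smul, Finset.sum_add_distrib]

theorem policy_sub (φ ψ : EuclideanSpace ℝ (Fin d)) (x : EuclideanSpace ℝ (Fin n)) :
    policy f (φ - ψ) x = policy f φ x - policy f ψ x := by
  simp [policy, sub_smul, Finset.sum_sub_distrib]

theorem policy_smul (a : ℝ) (φ : EuclideanSpace ℝ (Fin d)) (x : EuclideanSpace ℝ (Fin n)) :
    policy f (a • φ) x = a • policy f φ x := by
  simp [policy, Finset.smul_sum, mul_smul]

theorem map_policy {l : ℕ} (T : EuclideanSpace ℝ (Fin m) →ₗ[ℝ] EuclideanSpace ℝ (Fin l))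
    (φ : EuclideanSpace ℝ (Fin d)) (x : EuclideanSpace ℝ (Fin n)) :
    T (policy f φ x) = policy (fun k x => T (f k x)) φ x := by
  simp [policy]

theorem policy_eq_iff {f : Fin d → EuclideanSpace ℝ (Fin n) → EuclideanSpace ℝ (Fin m)}
    (hind : LinearIndependent ℝ f) {φ ψ : EuclideanSpace ℝ (Fin d)} :
    (∀ x, policy f φ x = policy f ψ x) ↔ φ = ψ := by
  refine ⟨fun h => ?_, fun h => by simp [h]⟩
  have h1 : ∑ k, (φ - ψ).ofLp k • f k = 0 := by
    funext x
    have h2 : policy f (φ - ψ) x = 0 := by rw [policy_sub, h x, sub_self]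
    rw [Finset.sum_apply]
    exact h2
  have h3 := Fintype.linearIndependent_iff.1 hind _ h1
  ext k
  exact sub_eq_zero.1 (h3 k)

/-- The policies `π_φ` are Lipschitz and of linear growth, uniformly in `φ`. -/
structure PolicyBound (p : EuclideanSpace ℝ (Fin n) → ℝ) (c : ℝ) : Prop where
  lip : ∀ φ x y, ‖policy f φ x - policy f φ y‖ ≤ c * ‖φ‖ * p (x - y)
  growth : ∀ φ x, ‖policy f φ x‖ ≤ c * ‖φ‖ * (p x + 1)

variable {f}

/-- Allowing every larger `c` lets the families `N ∘ f` and `S ∘ B ∘ f` share one constant. -/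
theorem exists_policyBound (hLip : ∀ k, ∃ L, LipschitzWith L (f k))
    {p : EuclideanSpace ℝ (Fin n) → ℝ} {κ : ℝ} (hp : ∀ x, ‖x‖ ≤ κ * p x)
    (hp0 : ∀ x, 0 ≤ p x) : ∃ c₀, ∀ c, c₀ ≤ c → PolicyBound f p c := by
  choose L hL using hLip
  let a : ℝ := ∑ k, (L k : ℝ)
  let b : ℝ := ∑ k, ‖f k 0‖
  have hφ : ∀ (φ : EuclideanSpace ℝ (Fin d)) k, ‖φ k‖ ≤ ‖φ‖ := fun φ k =>
    PiLp.norm_apply_le φ k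
  have ha : 0 ≤ a := Finset.sum_nonneg fun _ _ => NNReal.coe_nonneg _
  have hb : 0 ≤ b := Finset.sum_nonneg fun _ _ => norm_nonneg _
  have h1 : ∀ φ x y, ‖policy f φ x - policy f φ y‖ ≤ a * ‖φ‖ * ‖x - y‖ := by
    intro φ x y
    have h : policy f φ x - policy f φ y = ∑ k, φ k • (f k x - f k y) := by
      simp [policy, smul_sub, Finset.sum_sub_distrib]
    rw [h]
    calc ‖∑ k, φ k • (f k x - f k y)‖ ≤ ∑ k, ‖φ k • (f k x - f k y)‖ := norm_sum_le _ _
      _ ≤ ∑ k, (L k : ℝ) * (‖φ‖ * ‖x - y‖) := by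
          refine Finset.sum_le_sum fun k _ => ?_
          rw [norm_smul]
          calc ‖φ k‖ * ‖f k x - f k y‖ ≤ ‖φ‖ * (L k * ‖x - y‖) := by
                gcongr
                · exact hφ φ k
                · exact (hL k).norm_sub_le x y
            _ = _ := by ring
      _ = _ := by rw [← Finset.sum_mul]; ring
  have h2 : ∀ φ, ‖policy f φ 0‖ ≤ b * ‖φ‖ := by
    intro φ
    calc ‖policy f φ 0‖ ≤ ∑ k, ‖φ k • f k 0‖ := norm_sum_le _ _
      _ ≤ ∑ k, ‖f k 0‖ * ‖φ‖ := by
          refine Finset.sum_le_sum fun k _ => ?_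
          rw [norm_smul, mul_comm]
          gcongr
          exact hφ φ k
      _ = _ := by rw [← Finset.sum_mul]
  refine ⟨a * |κ| + b, fun c hc => ⟨fun φ x y => ?_, fun φ x => ?_⟩⟩
  · have hκ : ‖x - y‖ ≤ |κ| * p (x - y) :=
      (hp _).trans (mul_le_mul_of_nonneg_right (le_abs_self κ) (hp0 _))
    calc _ ≤ a * ‖φ‖ * ‖x - y‖ := h1 φ x y
      _ ≤ a * ‖φ‖ * (|κ| * p (x - y)) := by gcongr
      _ = (a * |κ|) * ‖φ‖ * p (x - y) := by ring
      _ ≤ c * ‖φ‖ * p (x - y) := by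
          have := hp0 (x - y)
          gcongr
          linarith
  · have hκ : ‖x‖ ≤ |κ| * p x :=
      (hp _).trans (mul_le_mul_of_nonneg_right (le_abs_self κ) (hp0 _))
    calc ‖policy f φ x‖ ≤ ‖policy f φ x - policy f φ 0‖ + ‖policy f φ 0‖ := norm_le_norm_sub_add _ _
      _ ≤ a * ‖φ‖ * ‖x - 0‖ + b * ‖φ‖ := add_le_add (h1 φ x 0) (h2 φ)
      _ ≤ a * ‖φ‖ * (|κ| * p x) + b * ‖φ‖ := by rw [sub_zero]; gcongr
      _ = (a * |κ|) * ‖φ‖ * p x + b * ‖φ‖ := by ring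
      _ ≤ c * ‖φ‖ * p x + c * ‖φ‖ := by
          have := hp0 x
          have : 0 ≤ a * |κ| := by positivity
          gcongr <;> linarith
      _ = _ := by ring

theorem continuous_policy (hLip : ∀ k, ∃ L, LipschitzWith L (f k))
    (φ : EuclideanSpace ℝ (Fin d)) : Continuous (policy f φ) := by
  unfold policy
  refine continuous_finsetSum _ fun k _ => ?_
  obtain ⟨L, hL⟩ := hLip k
  exact hL.continuous.const_smul (φ k)

end Policy

/-! ### Decay and parameter dependence of perturbed orbits. -/

section Dynamics

variable {X W E : Type*} [NormedAddCommGroup X] [NormedSpace ℝ X] [NormedAddCommGroup W]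
  [NormedSpace ℝ W] [NormedAddCommGroup E]

/-- The closed loop `x ↦ Λ x + b φ x` in the norm `‖S ·‖`: its linear part contracts by `ρ` after
the scaling by `s`, and its perturbation `b φ` is Lipschitz of linear growth, uniformly in `φ`. -/
structure IsPerturbedLinear (Λ : X →ₗ[ℝ] X) (b : E → X → X) (S : X →L[ℝ] W)
    (s ρ c : ℝ) : Prop where
  contract : ∀ x, s * ‖S (Λ x)‖ ≤ ρ * ‖S x‖
  lip : ∀ φ x y, ‖S (b φ x - b φ y)‖ ≤ c * ‖φ‖ * ‖S (x - y)‖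
  growth : ∀ φ x, ‖S (b φ x)‖ ≤ c * ‖φ‖ * (‖S x‖ + 1)
  param : ∀ φ ψ x, ‖S (b φ x - b ψ x)‖ ≤ c * ‖φ - ψ‖ * (‖S x‖ + 1)

/-- The orbit of the closed loop. -/
def orbit (Λ : X →ₗ[ℝ] X) (b : E → X → X) (φ : E) (x : X) (t : ℕ) : X :=
  (fun x => Λ x + b φ x)^[t] x

variable {Λ : X →ₗ[ℝ] X} {b : E → X → X} {S : X →L[ℝ] W} {s ρ c β β' : ℝ}

omit [NormedAddCommGroup E] in
theorem orbit_succ (φ : E) (x : X) (t : ℕ) :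
    orbit Λ b φ x (t + 1) = Λ (orbit Λ b φ x t) + b φ (orbit Λ b φ x t) :=
  Function.iterate_succ_apply' _ _ _

/-- The `+ 1` accounts for perturbations that do not vanish at `0`. Scaling shrinks it only by the
factor `s`, whence the second condition on `β`. -/
theorem IsPerturbedLinear.growth_orbit (h : IsPerturbedLinear Λ b S s ρ c) (hs0 : 0 ≤ s)
    (hs1 : s ≤ 1) (hc : 0 ≤ c) {φ : E} (hρ : ρ + c * ‖φ‖ ≤ β) (hsβ : s + c * ‖φ‖ ≤ β)
    (x : X) (t : ℕ) :
    s ^ t * (‖S (orbit Λ b φ x t)‖ + 1) ≤ β ^ t * (‖S x‖ + 1) := by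
  have hβ : 0 ≤ β := le_trans (by positivity) hsβ
  induction t with
  | zero => simp [orbit]
  | succ t ih =>
    set z := orbit Λ b φ x t
    have h1 : s * (‖S (orbit Λ b φ x (t + 1))‖ + 1) ≤ β * (‖S z‖ + 1) := by
      rw [orbit_succ, map_add]
      have h2 := norm_add_le (S (Λ z)) (S (b φ z))
      have h3 := h.contract z
      have h4 := h.growth φ z
      have h5 : s * ‖S (b φ z)‖ ≤ c * ‖φ‖ * (‖S z‖ + 1) :=
        (mul_le_of_le_one_left (norm_nonneg _) hs1).trans h4
      have h6 := mul_le_mul_of_nonneg_right hρ (norm_nonneg (S z))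
      nlinarith [mul_le_mul_of_nonneg_left h2 hs0]
    calc s ^ (t + 1) * (‖S (orbit Λ b φ x (t + 1))‖ + 1)
        = s ^ t * (s * (‖S (orbit Λ b φ x (t + 1))‖ + 1)) := by ring
      _ ≤ s ^ t * (β * (‖S z‖ + 1)) := by gcongr
      _ = β * (s ^ t * (‖S z‖ + 1)) := by ring
      _ ≤ β * (β ^ t * (‖S x‖ + 1)) := by gcongr
      _ = _ := by ring

/-- The scaled distance obeys `D (t + 1) ≤ β D t + c ‖φ - ψ‖ β' ^ t (‖S x‖ + 1)`. The larger rate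
`β'` avoids a factor `t`, and `c / (β' - β)` solves `β k + c = β' k`. -/
theorem IsPerturbedLinear.lipschitz_orbit (h : IsPerturbedLinear Λ b S s ρ c) (hs0 : 0 ≤ s)
    (hs1 : s ≤ 1) (hc : 0 ≤ c) {φ ψ : E} (hφ : ρ + c * ‖φ‖ ≤ β) (hψ : ρ + c * ‖ψ‖ ≤ β)
    (hψs : s + c * ‖ψ‖ ≤ β) (hβ' : β < β') (x : X) (t : ℕ) :
    s ^ t * ‖S (orbit Λ b φ x t - orbit Λ b ψ x t)‖ ≤
      c / (β' - β) * ‖φ - ψ‖ * (β' ^ t * (‖S x‖ + 1)) := by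
  have hβ : 0 ≤ β := le_trans (by positivity) hψs
  have hd : 0 < β' - β := sub_pos.2 hβ'
  induction t with
  | zero =>
    simp only [orbit, Function.iterate_zero, id, sub_self, map_zero, norm_zero, mul_zero]
    positivity
  | succ t ih =>
    have hg := h.growth_orbit hs0 hs1 hc hψ hψs x t
    set z := orbit Λ b φ x t
    set w := orbit Λ b ψ x t
    have h1 : s * ‖S (orbit Λ b φ x (t + 1) - orbit Λ b ψ x (t + 1))‖ ≤
        β * ‖S (z - w)‖ + c * ‖φ - ψ‖ * (‖S w‖ + 1) := by
      have e : orbit Λ b φ x (t + 1) - orbit Λ b ψ x (t + 1) =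
          Λ (z - w) + (b φ z - b φ w) + (b φ w - b ψ w) := by
        rw [orbit_succ, orbit_succ, map_sub]; abel
      rw [e, map_add, map_add]
      have h2 := norm_add₃_le (a := S (Λ (z - w))) (b := S (b φ z - b φ w)) (c := S (b φ w - b ψ w))
      have h3 := h.contract (z - w)
      have h4 : s * ‖S (b φ z - b φ w)‖ ≤ _ :=
        (mul_le_of_le_one_left (norm_nonneg _) hs1).trans (h.lip φ z w)
      have h5 : s * ‖S (b φ w - b ψ w)‖ ≤ _ :=
        (mul_le_of_le_one_left (norm_nonneg _) hs1).trans (h.param φ ψ w)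
      have h6 := mul_le_mul_of_nonneg_right hφ (norm_nonneg (S (z - w)))
      nlinarith [mul_le_mul_of_nonneg_left h2 hs0]
    have h7 : s ^ t * (‖S w‖ + 1) ≤ β' ^ t * (‖S x‖ + 1) := hg.trans (by gcongr)
    have h8 : 0 ≤ β' := hβ.trans hβ'.le
    calc s ^ (t + 1) * ‖S (orbit Λ b φ x (t + 1) - orbit Λ b ψ x (t + 1))‖
        = s ^ t * (s * ‖S (orbit Λ b φ x (t + 1) - orbit Λ b ψ x (t + 1))‖) := by ring
      _ ≤ s ^ t * (β * ‖S (z - w)‖ + c * ‖φ - ψ‖ * (‖S w‖ + 1)) := by gcongr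
      _ = β * (s ^ t * ‖S (z - w)‖) + c * ‖φ - ψ‖ * (s ^ t * (‖S w‖ + 1)) := by ring
      _ ≤ β * (c / (β' - β) * ‖φ - ψ‖ * (β' ^ t * (‖S x‖ + 1)))
          + c * ‖φ - ψ‖ * (β' ^ t * (‖S x‖ + 1)) := by
          gcongr
      _ = c / (β' - β) * ‖φ - ψ‖ * (β' ^ (t + 1) * (‖S x‖ + 1)) := by
          field_simp
          ring

end Dynamics

/-! ### From a Lipschitz family of linear maps to a nearly quadratic function. -/

section Perturbation

variable {E H : Type*} [NormedAddCommGroup E] [InnerProductSpace ℝ E]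
  [NormedAddCommGroup H] [InnerProductSpace ℝ H]

omit [NormedAddCommGroup E] [InnerProductSpace ℝ E] in
theorem norm_add_sq_sub_norm_add_sq (p q a b : H) :
    (‖p + a‖ ^ 2 - ‖p‖ ^ 2) - (‖q + b‖ ^ 2 - ‖q‖ ^ 2) =
      2 * inner ℝ (p - q) a + 2 * inner ℝ q (a - b) + inner ℝ (a - b) (a + b) := by
  rw [norm_add_sq_real, norm_add_sq_real, inner_sub_left, inner_sub_right,
    inner_sub_left, inner_add_right, inner_add_right, real_inner_self_eq_norm_sq,
    real_inner_self_eq_norm_sq, real_inner_comm b a]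
  ring

/-- If `F (x₀ + φ) = c₀ + ‖T φ φ‖²`, where `T φ` is linear and depends on `φ` in a Lipschitz way,
then `F` is close to the quadratic form of `T 0` at `x₀`. -/
theorem isQuadraticNear_of_family {F : E → ℝ} {x₀ : E} {c₀ δ K : ℝ} {T : E → E →ₗ[ℝ] H}
    (L : E →L[ℝ] H) (hL : ∀ φ, L φ = T 0 φ) (hδ : δ ≤ 1) (hK : 0 ≤ K)
    (hb : ∀ φ, ‖T 0 φ‖ ≤ K * ‖φ‖)
    (hlip : ∀ ψ ψ' φ, ‖ψ‖ ≤ δ → ‖ψ'‖ ≤ δ → ‖T ψ φ - T ψ' φ‖ ≤ K * ‖φ‖ * ‖ψ - ψ'‖)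
    (hF : ∀ φ, ‖φ‖ ≤ δ → F (x₀ + φ) = c₀ + ‖T φ φ‖ ^ 2) :
    IsQuadraticNear F L x₀ δ (10 * K ^ 2) := by
  intro r hr x y hx hy
  obtain ⟨φ, rfl⟩ : ∃ φ, x = x₀ + φ := ⟨x - x₀, by simp⟩
  obtain ⟨ψ, rfl⟩ : ∃ ψ, y = x₀ + ψ := ⟨y - x₀, by simp⟩
  rw [add_sub_cancel_left] at hx hy ⊢
  rw [add_sub_cancel_left, add_sub_add_left_eq_sub, hF φ (hx.trans hr), hF ψ (hy.trans hr), hL, hL]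
  have hr0 : 0 ≤ r := (norm_nonneg φ).trans hx
  have h0 : ‖(0 : E)‖ ≤ δ := by rw [norm_zero]; exact hr0.trans hr
  set a := T φ φ - T 0 φ with ha
  set b := T ψ ψ - T 0 ψ with hb'
  set d := ‖φ - ψ‖ with hd
  have hd0 : 0 ≤ d := norm_nonneg _
  have h1 : ‖a‖ ≤ K * r * r := by
    refine (hlip φ 0 φ (hx.trans hr) h0).trans ?_
    rw [sub_zero]
    gcongr
  have h2 : ‖b‖ ≤ K * r * r := by
    refine (hlip ψ 0 ψ (hy.trans hr) h0).trans ?_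
    rw [sub_zero]
    gcongr
  -- The difference is split so that either the argument or the parameter changes, each contributing
  -- `K r d`.
  have h3 : ‖a - b‖ ≤ 2 * K * r * d := by
    have e : a - b = (T φ (φ - ψ) - T 0 (φ - ψ)) + (T φ ψ - T ψ ψ) := by
      rw [ha, hb', map_sub, map_sub]; abel
    rw [e]
    refine (norm_add_le _ _).trans ?_
    have h4 := hlip φ 0 (φ - ψ) (hx.trans hr) h0
    have h5 := hlip φ ψ ψ (hx.trans hr) (hy.trans hr)
    rw [sub_zero] at h4
    have h6 : K * d * ‖φ‖ ≤ K * d * r := by gcongr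
    have h7 : K * ‖ψ‖ * d ≤ K * r * d := by gcongr
    linarith
  have e : c₀ + ‖T φ φ‖ ^ 2 - ‖T 0 φ‖ ^ 2 - (c₀ + ‖T ψ ψ‖ ^ 2 - ‖T 0 ψ‖ ^ 2) =
      2 * inner ℝ (T 0 (φ - ψ)) a + 2 * inner ℝ (T 0 ψ) (a - b) + inner ℝ (a - b) (a + b) := by
    rw [map_sub, ← norm_add_sq_sub_norm_add_sq, ha, hb', add_sub_cancel, add_sub_cancel]
    ring
  rw [e]
  have i1 : |inner ℝ (T 0 (φ - ψ)) a| ≤ (K * d) * (K * r * r) :=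
    (abs_real_inner_le_norm _ _).trans (mul_le_mul (hb _) h1 (norm_nonneg _) (by positivity))
  have i2 : |inner ℝ (T 0 ψ) (a - b)| ≤ (K * r) * (2 * K * r * d) :=
    (abs_real_inner_le_norm _ _).trans
      (mul_le_mul ((hb _).trans (by gcongr)) h3 (norm_nonneg _) (by positivity))
  have i3 : |inner ℝ (a - b) (a + b)| ≤ (2 * K * r * d) * (2 * K * r * r) :=
    (abs_real_inner_le_norm _ _).trans
      (mul_le_mul h3 ((norm_add_le _ _).trans (by linarith)) (norm_nonneg _) (by positivity))
  -- With `r ≤ 1` the three terms are at most `2`, `4` and `4` times `K² r² d`, which explains the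
  -- constant `10`.
  have i4 : K ^ 2 * r ^ 2 * d * r ≤ K ^ 2 * r ^ 2 * d * 1 := by
    gcongr
    exact hr.trans hδ
  refine (abs_add_le _ _).trans ?_
  refine (add_le_add_left (abs_add_le _ _) _).trans ?_
  rw [abs_mul, abs_mul, abs_two]
  nlinarith

end Perturbation

/-! ### The output operator into `L²(ρ₀ × count)`. -/

section Output

variable {n m d : ℕ} {W : Type*} [NormedAddCommGroup W] [NormedSpace ℝ W]
  (f : Fin d → EuclideanSpace ℝ (Fin n) → EuclideanSpace ℝ (Fin m))
  (Λ : EuclideanSpace ℝ (Fin n) →ₗ[ℝ] EuclideanSpace ℝ (Fin n))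
  (b : EuclideanSpace ℝ (Fin d) → EuclideanSpace ℝ (Fin n) → EuclideanSpace ℝ (Fin n))
  (S : EuclideanSpace ℝ (Fin n) →L[ℝ] W) (s ρ c β β' δ : ℝ)
  (ρ₀ : Measure (EuclideanSpace ℝ (Fin n)))

/-- The output of the policy `π_φ` along the orbit of the closed loop of `ψ`, scaled by `s ^ t`. -/
noncomputable def output (ψ φ : EuclideanSpace ℝ (Fin d)) (z : EuclideanSpace ℝ (Fin n) × ℕ) :
    EuclideanSpace ℝ (Fin m) :=
  s ^ z.2 • policy f φ (orbit Λ b ψ z.1 z.2)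

/-- The function that dominates the scaled outputs. -/
noncomputable def dominant (z : EuclideanSpace ℝ (Fin n) × ℕ) : ℝ := β' ^ z.2 * (‖S z.1‖ + 1)

open Classical in
/-- `output` as a linear map to `L²(ρ₀ × count)`. -/
noncomputable def outputLp (ψ : EuclideanSpace ℝ (Fin d)) :
    EuclideanSpace ℝ (Fin d) →ₗ[ℝ] Lp (EuclideanSpace ℝ (Fin m)) 2
      (ρ₀.prod (Measure.count : Measure ℕ)) :=
  -- For a stable loop and `‖ψ‖ ≤ δ` this holds by `memLp_output`, so the default `0` is not met
  -- there.
  if h : ∀ φ, MemLp (output f Λ b s ψ φ) 2 (ρ₀.prod (Measure.count : Measure ℕ)) then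
    { toFun := fun φ => (h φ).toLp _
      map_add' := fun φ φ' => by
        rw [← MemLp.toLp_add]
        congr 1
        funext z
        simp [output, policy_add]
      map_smul' := fun a φ => by
        rw [RingHom.id_apply, ← MemLp.toLp_const_smul]
        congr 1
        funext z
        simp only [output, policy_smul, Pi.smul_apply]
        rw [smul_comm] }
  else 0

variable {f Λ b S s ρ c β β' δ ρ₀}

theorem outputLp_apply {ψ : EuclideanSpace ℝ (Fin d)}
    (h : ∀ φ, MemLp (output f Λ b s ψ φ) 2 (ρ₀.prod (Measure.count : Measure ℕ)))
    (φ : EuclideanSpace ℝ (Fin d)) : outputLp f Λ b s ρ₀ ψ φ = (h φ).toLp _ := by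
  rw [outputLp, dif_pos h]
  rfl

theorem dominant_nonneg (hβ : 0 ≤ β') (z : EuclideanSpace ℝ (Fin n) × ℕ) :
    0 ≤ dominant S β' z := by
  unfold dominant; positivity

theorem memLp_dominant [IsProbabilityMeasure ρ₀] (hβ0 : 0 ≤ β') (hβ1 : β' < 1)
    (hmom : Integrable (fun x => ‖x‖ ^ 2) ρ₀) :
    MemLp (dominant S β') 2 (ρ₀.prod (Measure.count : Measure ℕ)) := by
  have h1 : Integrable (fun x => (‖S x‖ + 1) ^ 2) ρ₀ := by
    refine ((hmom.const_mul (2 * ‖S‖ ^ 2)).add (integrable_const (2 : ℝ))).mono' ?_ ?_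
    · have : Continuous fun x => (‖S x‖ + 1) ^ 2 := by fun_prop
      exact this.aestronglyMeasurable
    · refine Eventually.of_forall fun x => ?_
      rw [Real.norm_of_nonneg (by positivity), Pi.add_apply]
      have h2 := pow_le_pow_left₀ (norm_nonneg _) (S.le_opNorm x) 2
      nlinarith [sq_nonneg (‖S x‖ - 1)]
  have h2 : Integrable (fun t : ℕ => (β' ^ t) ^ 2) (Measure.count : Measure ℕ) := by
    rw [integrable_count_iff]
    have h3 : Summable fun t : ℕ => (β' ^ 2) ^ t :=
      summable_geometric_of_lt_one (sq_nonneg _) (pow_lt_one₀ hβ0 hβ1 two_ne_zero)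
    refine h3.congr fun t => ?_
    rw [Real.norm_of_nonneg (by positivity), ← pow_mul, ← pow_mul, mul_comm]
  have hm : AEStronglyMeasurable (dominant S β') (ρ₀.prod (Measure.count : Measure ℕ)) := by
    refine Measurable.aestronglyMeasurable ?_
    refine Measurable.mul ?_ ?_
    · exact (measurable_of_countable fun t : ℕ => β' ^ t).comp measurable_snd
    · have : Continuous fun x => ‖S x‖ + 1 := by fun_prop
      exact this.measurable.comp measurable_fst
  rw [memLp_two_iff_integrable_sq hm]
  refine (h1.mul_prod h2).congr (Eventually.of_forall fun z => ?_)
  simp only [dominant]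
  ring

theorem continuous_orbit (hb : ∀ φ, Continuous (b φ)) (φ : EuclideanSpace ℝ (Fin d)) (t : ℕ) :
    Continuous fun x => orbit Λ b φ x t := by
  have h : Continuous fun x => Λ x + b φ x :=
    (LinearMap.continuous_of_finiteDimensional Λ).add (hb φ)
  exact h.iterate t

theorem measurable_output (hb : ∀ φ, Continuous (b φ)) (hf : ∀ φ, Continuous (policy f φ))
    (ψ φ : EuclideanSpace ℝ (Fin d)) : Measurable (output f Λ b s ψ φ) :=
  measurable_from_prod_countable_left fun t =>
    (((hf φ).comp (continuous_orbit hb ψ t)).const_smul (s ^ t)).measurable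

/-- The standing assumptions on the closed loop and its output. -/
structure IsStableLoop (f : Fin d → EuclideanSpace ℝ (Fin n) → EuclideanSpace ℝ (Fin m))
    (Λ : EuclideanSpace ℝ (Fin n) →ₗ[ℝ] EuclideanSpace ℝ (Fin n))
    (b : EuclideanSpace ℝ (Fin d) → EuclideanSpace ℝ (Fin n) → EuclideanSpace ℝ (Fin n))
    (S : EuclideanSpace ℝ (Fin n) →L[ℝ] W) (s ρ c β β' δ : ℝ) : Prop where
  pert : IsPerturbedLinear Λ b S s ρ c
  bound : PolicyBound f (fun x => ‖S x‖) c
  continuous_pert : ∀ φ, Continuous (b φ)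
  continuous_policy : ∀ φ, Continuous (policy f φ)
  s_nonneg : 0 ≤ s
  s_le_one : s ≤ 1
  c_nonneg : 0 ≤ c
  δ_nonneg : 0 ≤ δ
  rho_le : ρ + c * δ ≤ β
  s_le : s + c * δ ≤ β
  lt : β < β'
  lt_one : β' < 1

namespace IsStableLoop

variable (h : IsStableLoop f Λ b S s ρ c β β' δ)

include h

theorem rate_nonneg : 0 ≤ β' := by
  have h1 : 0 ≤ s + c * δ := add_nonneg h.s_nonneg (mul_nonneg h.c_nonneg h.δ_nonneg)
  linarith [h.s_le, h.lt]

theorem rho_le' {φ : EuclideanSpace ℝ (Fin d)} (hφ : ‖φ‖ ≤ δ) : ρ + c * ‖φ‖ ≤ β := by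
  linarith [h.rho_le, mul_le_mul_of_nonneg_left hφ h.c_nonneg]

theorem s_le' {φ : EuclideanSpace ℝ (Fin d)} (hφ : ‖φ‖ ≤ δ) : s + c * ‖φ‖ ≤ β := by
  linarith [h.s_le, mul_le_mul_of_nonneg_left hφ h.c_nonneg]

theorem growth_le {ψ : EuclideanSpace ℝ (Fin d)} (hψ : ‖ψ‖ ≤ δ)
    (x : EuclideanSpace ℝ (Fin n)) (t : ℕ) :
    s ^ t * (‖S (orbit Λ b ψ x t)‖ + 1) ≤ β' ^ t * (‖S x‖ + 1) := by
  refine (h.pert.growth_orbit h.s_nonneg h.s_le_one h.c_nonneg (h.rho_le' hψ) (h.s_le' hψ)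
    x t).trans ?_
  have h1 : 0 ≤ s + c * ‖ψ‖ := add_nonneg h.s_nonneg (mul_nonneg h.c_nonneg (norm_nonneg _))
  have h2 : 0 ≤ β := h1.trans (h.s_le' hψ)
  have h3 := h.lt
  gcongr

theorem norm_output_le {ψ : EuclideanSpace ℝ (Fin d)} (hψ : ‖ψ‖ ≤ δ)
    (φ : EuclideanSpace ℝ (Fin d)) (z : EuclideanSpace ℝ (Fin n) × ℕ) :
    ‖output f Λ b s ψ φ z‖ ≤ c * ‖φ‖ * dominant S β' z := by
  have hs := h.s_nonneg
  have hc := h.c_nonneg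
  rw [output, norm_smul, Real.norm_of_nonneg (by positivity)]
  calc s ^ z.2 * ‖policy f φ (orbit Λ b ψ z.1 z.2)‖
      ≤ s ^ z.2 * (c * ‖φ‖ * (‖S (orbit Λ b ψ z.1 z.2)‖ + 1)) := by
        gcongr
        exact h.bound.growth _ _
    _ = c * ‖φ‖ * (s ^ z.2 * (‖S (orbit Λ b ψ z.1 z.2)‖ + 1)) := by ring
    _ ≤ c * ‖φ‖ * dominant S β' z := by
        gcongr
        exact h.growth_le hψ _ _

theorem norm_output_sub_le {ψ ψ' : EuclideanSpace ℝ (Fin d)} (hψ : ‖ψ‖ ≤ δ) (hψ' : ‖ψ'‖ ≤ δ)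
    (φ : EuclideanSpace ℝ (Fin d)) (z : EuclideanSpace ℝ (Fin n) × ℕ) :
    ‖output f Λ b s ψ φ z - output f Λ b s ψ' φ z‖ ≤
      c * (c / (β' - β)) * ‖φ‖ * ‖ψ - ψ'‖ * dominant S β' z := by
  have hs := h.s_nonneg
  have hc := h.c_nonneg
  rw [output, output, ← smul_sub, norm_smul, Real.norm_of_nonneg (by positivity)]
  calc _ ≤ s ^ z.2 * (c * ‖φ‖ * ‖S (orbit Λ b ψ z.1 z.2 - orbit Λ b ψ' z.1 z.2)‖) := by
        gcongr
        exact h.bound.lip _ _ _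
    _ = c * ‖φ‖ * (s ^ z.2 * ‖S (orbit Λ b ψ z.1 z.2 - orbit Λ b ψ' z.1 z.2)‖) := by ring
    _ ≤ c * ‖φ‖ * (c / (β' - β) * ‖ψ - ψ'‖ * dominant S β' z) := by
        refine mul_le_mul_of_nonneg_left ?_ (by positivity)
        exact h.pert.lipschitz_orbit h.s_nonneg h.s_le_one h.c_nonneg (h.rho_le' hψ)
          (h.rho_le' hψ') (h.s_le' hψ') h.lt _ _
    _ = _ := by ring

variable [IsProbabilityMeasure ρ₀] (hmom : Integrable (fun x => ‖x‖ ^ 2) ρ₀)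

include hmom

theorem memLp_output {ψ : EuclideanSpace ℝ (Fin d)} (hψ : ‖ψ‖ ≤ δ)
    (φ : EuclideanSpace ℝ (Fin d)) :
    MemLp (output f Λ b s ψ φ) 2 (ρ₀.prod (Measure.count : Measure ℕ)) := by
  refine (memLp_dominant (S := S) h.rate_nonneg h.lt_one hmom).of_le_mul (c := c * ‖φ‖)
    (measurable_output h.continuous_pert h.continuous_policy ψ φ).aestronglyMeasurable
    (Eventually.of_forall fun z => ?_)
  rw [Real.norm_of_nonneg (dominant_nonneg h.rate_nonneg z)]
  exact h.norm_output_le hψ φ z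

theorem exists_outputLp_bound : ∃ K, 0 ≤ K ∧
    (∀ φ, ‖outputLp f Λ b s ρ₀ 0 φ‖ ≤ K * ‖φ‖) ∧
    ∀ ψ ψ' φ, ‖ψ‖ ≤ δ → ‖ψ'‖ ≤ δ →
      ‖outputLp f Λ b s ρ₀ ψ φ - outputLp f Λ b s ρ₀ ψ' φ‖ ≤ K * ‖φ‖ * ‖ψ - ψ'‖ := by
  have hdom := memLp_dominant (S := S) (ρ₀ := ρ₀) h.rate_nonneg h.lt_one hmom
  set D := ‖hdom.toLp _‖ with hD
  have hc := h.c_nonneg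
  have hlt : 0 < β' - β := sub_pos.2 h.lt
  have h0 : ‖(0 : EuclideanSpace ℝ (Fin d))‖ ≤ δ := by rw [norm_zero]; exact h.δ_nonneg
  refine ⟨c * D + c * (c / (β' - β)) * D, by positivity, fun φ => ?_, fun ψ ψ' φ hψ hψ' => ?_⟩
  · rw [outputLp_apply (h.memLp_output hmom h0)]
    have h1 : ‖(h.memLp_output hmom h0 φ).toLp _‖ ≤ c * ‖φ‖ * D := by
      refine Lp.norm_le_mul_norm_of_ae_le_mul ?_
      filter_upwards [hdom.coeFn_toLp, (h.memLp_output hmom h0 φ).coeFn_toLp] with z h1 h2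
      rw [h1, h2, Real.norm_of_nonneg (dominant_nonneg h.rate_nonneg z)]
      exact h.norm_output_le h0 φ z
    have h2 : 0 ≤ c * (c / (β' - β)) * D * ‖φ‖ := by positivity
    linarith
  · rw [outputLp_apply (h.memLp_output hmom hψ), outputLp_apply (h.memLp_output hmom hψ'),
      ← MemLp.toLp_sub]
    have h1 : ‖((h.memLp_output hmom hψ φ).sub (h.memLp_output hmom hψ' φ)).toLp _‖ ≤
        c * (c / (β' - β)) * ‖φ‖ * ‖ψ - ψ'‖ * D := by
      refine Lp.norm_le_mul_norm_of_ae_le_mul ?_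
      filter_upwards [hdom.coeFn_toLp,
        ((h.memLp_output hmom hψ φ).sub (h.memLp_output hmom hψ' φ)).coeFn_toLp] with z h1 h2
      rw [h1, h2, Real.norm_of_nonneg (dominant_nonneg h.rate_nonneg z)]
      exact h.norm_output_sub_le hψ hψ' φ z
    have h2 : 0 ≤ c * D * ‖φ‖ * ‖ψ - ψ'‖ := by positivity
    linarith

theorem ofReal_norm_outputLp_sq {ψ : EuclideanSpace ℝ (Fin d)} (hψ : ‖ψ‖ ≤ δ)
    (φ : EuclideanSpace ℝ (Fin d)) :
    ENNReal.ofReal (‖outputLp f Λ b s ρ₀ ψ φ‖ ^ 2) =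
      ∫⁻ x, ∑' t, ‖output f Λ b s ψ φ (x, t)‖ₑ ^ 2 ∂ρ₀ := by
  have hm := h.memLp_output hmom hψ φ
  have hmeas := measurable_output (Λ := Λ) (s := s) h.continuous_pert h.continuous_policy ψ φ
  rw [outputLp_apply (h.memLp_output hmom hψ), ENNReal.ofReal_pow (norm_nonneg _),
    ofReal_norm, Lp.enorm_toLp]
  have h1 := eLpNorm_nnreal_pow_eq_lintegral (μ := ρ₀.prod (Measure.count : Measure ℕ))
    (f := output f Λ b s ψ φ) (p := 2) two_ne_zero
  have h2 : ((2 : NNReal) : ℝ≥0∞) = 2 := rfl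
  have h3 : ((2 : NNReal) : ℝ) = ((2 : ℕ) : ℝ) := by norm_num
  rw [h2, h3] at h1
  simp only [ENNReal.rpow_natCast] at h1
  rw [h1, lintegral_prod _ (hmeas.enorm.pow_const 2).aemeasurable]
  simp only [lintegral_count]

/-- Time `0` alone suffices: there the output is `π_φ(x₀)`. A continuous function vanishing
`ρ₀`-almost everywhere vanishes identically under full support, and linear independence gives `φ =
0`. -/
theorem outputLp_injective (hind : LinearIndependent ℝ f) (hsupp : ρ₀.IsOpenPosMeasure) :
    LinearMap.ker (outputLp f Λ b s ρ₀ 0) = ⊥ := by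
  have h0 : ‖(0 : EuclideanSpace ℝ (Fin d))‖ ≤ δ := by rw [norm_zero]; exact h.δ_nonneg
  refine LinearMap.ker_eq_bot'.2 fun φ hφ => ?_
  rw [outputLp_apply (h.memLp_output hmom h0)] at hφ
  have h1 := (h.memLp_output hmom h0 φ).coeFn_toLp
  rw [hφ] at h1
  have h2 := (Lp.coeFn_zero (EuclideanSpace ℝ (Fin m)) 2
    (ρ₀.prod (Measure.count : Measure ℕ))).symm.trans h1
  have h3 : policy f φ =ᵐ[ρ₀] fun _ => 0 := by
    filter_upwards [Measure.ae_ae_of_ae_prod h2] with x hx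
    have := (Measure.ae_count_iff.1 hx) 0
    simpa [output, orbit] using this.symm
  have h4 := (Continuous.ae_eq_iff_eq ρ₀ (h.continuous_policy φ) continuous_const).1 h3
  refine (policy_eq_iff hind).1 fun x => ?_
  rw [h4]
  simp [policy]

end IsStableLoop

end Output

/-- Summability of `v` makes the shifted sum finite, hence cancellable in `ℝ≥0∞`; the sums of `a`
and `e` may be infinite. -/
theorem tsum_ofReal_of_telescoping {a v e : ℕ → ℝ} (ha : ∀ t, 0 ≤ a t) (hv : ∀ t, 0 ≤ v t)
    (he : ∀ t, 0 ≤ e t) (h : ∀ t, a t + v (t + 1) = v t + e t) (hs : Summable v) :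
    ∑' t, ENNReal.ofReal (a t) = ENNReal.ofReal (v 0) + ∑' t, ENNReal.ofReal (e t) := by
  have h1 : ∑' t, ENNReal.ofReal (v (t + 1)) ≠ ⊤ :=
    ((summable_nat_add_iff 1).2 hs).tsum_ofReal_ne_top
  have h2 : ∑' t, ENNReal.ofReal (a t) + ∑' t, ENNReal.ofReal (v (t + 1)) =
      ∑' t, ENNReal.ofReal (v t) + ∑' t, ENNReal.ofReal (e t) := by
    rw [← ENNReal.tsum_add, ← ENNReal.tsum_add]
    refine tsum_congr fun t => ?_
    rw [← ENNReal.ofReal_add (ha t) (hv _), ← ENNReal.ofReal_add (hv t) (he t), h t]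
  rw [tsum_eq_zero_add' (f := fun t => ENNReal.ofReal (v t)) ENNReal.summable,
    add_right_comm] at h2
  exact (ENNReal.add_left_inj h1).1 h2

/-! ### The cost as a constant plus a squared output norm. -/

section Cost

variable {n m d : ℕ} (A : Matrix (Fin n) (Fin n) ℝ) (B : Matrix (Fin n) (Fin m) ℝ)
  (Q : Matrix (Fin n) (Fin n) ℝ) (R : Matrix (Fin m) (Fin m) ℝ) (γ : ℝ)
  (f : Fin d → EuclideanSpace ℝ (Fin n) → EuclideanSpace ℝ (Fin m))

/-- The closed loop `A + B K_γ^*` of the optimal feedback. -/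
noncomputable def optimalLoop : EuclideanSpace ℝ (Fin n) →ₗ[ℝ] EuclideanSpace ℝ (Fin n) :=
  Matrix.toEuclideanLin A +
    Matrix.toEuclideanLin B ∘ₗ Matrix.toEuclideanLin (optimalGain A B Q R γ)

/-- The perturbation `x ↦ B π_φ(x)` of the closed loop. -/
noncomputable def loopPerturbation (φ : EuclideanSpace ℝ (Fin d)) (x : EuclideanSpace ℝ (Fin n)) :
    EuclideanSpace ℝ (Fin n) :=
  Matrix.toEuclideanLin B (policy f φ x)

variable {A B Q R γ f}

theorem stageCost_nonneg (hQ : Q.PosDef) (hR : R.PosDef) (x : EuclideanSpace ℝ (Fin n))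
    (u : EuclideanSpace ℝ (Fin m)) : 0 ≤ stageCost Q R x u := by
  rw [stageCost, inner_toEuclideanLin, inner_toEuclideanLin]
  exact add_nonneg (quadForm_nonneg hQ.posSemidef _) (quadForm_nonneg hR.posSemidef _)

theorem stageCost_add_eq (hQ : Q.PosDef) (hR : R.PosDef) (hγ : 0 ≤ γ) (hAB : IsControllable A B)
    {S : EuclideanSpace ℝ (Fin n) →L[ℝ] EuclideanSpace ℝ (Fin n)}
    (hS : ∀ x, ‖S x‖ ^ 2 = quadForm (riccatiMatrix A B Q R γ) x.ofLp)
    {N : EuclideanSpace ℝ (Fin m) →L[ℝ] EuclideanSpace ℝ (Fin m)}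
    (hN : ∀ x, ‖N x‖ ^ 2 = quadForm (inputWeight B R γ (riccatiMatrix A B Q R γ)) x.ofLp)
    (x : EuclideanSpace ℝ (Fin n)) (w : EuclideanSpace ℝ (Fin m)) :
    stageCost Q R x (Matrix.toEuclideanLin (optimalGain A B Q R γ) x + w) +
      γ * ‖S (optimalLoop A B Q R γ x + Matrix.toEuclideanLin B w)‖ ^ 2 =
        ‖S x‖ ^ 2 + ‖N w‖ ^ 2 := by
  obtain ⟨hP, hfix⟩ := riccatiMatrix_spec hQ hR hγ hAB
  have h := bellman_eq A B Q hR hγ hP.posSemidef x.ofLp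
    (optimalGain A B Q R γ *ᵥ x.ofLp + w.ofLp)
  rw [show riccatiStep A B Q R γ (riccatiMatrix A B Q R γ) = riccatiMatrix A B Q R γ from
    hfix.symm] at h
  have h1 : optimalGain A B Q R γ *ᵥ x.ofLp + w.ofLp -
      greedyGain A B R γ (riccatiMatrix A B Q R γ) *ᵥ x.ofLp = w.ofLp := by
    rw [add_sub_assoc]
    exact add_sub_cancel _ _
  rw [h1, ← hN] at h
  rw [hS x, ← h, stageCost, inner_toEuclideanLin, inner_toEuclideanLin, hS]
  congr 3
  simp [optimalLoop, Matrix.mulVec_add, add_assoc]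

/-- `V` is a Lyapunov function: at `w = 0` the Bellman identity gives `γ V(Λ x) ≤ V(x) - xᵀ Q x`,
and `Q` dominates a multiple of `P`. -/
theorem sqrt_mul_norm_optimalLoop_le (hQ : Q.PosDef) (hR : R.PosDef) (hγ : 0 ≤ γ)
    (hAB : IsControllable A B)
    {S : EuclideanSpace ℝ (Fin n) →L[ℝ] EuclideanSpace ℝ (Fin n)}
    (hS : ∀ x, ‖S x‖ ^ 2 = quadForm (riccatiMatrix A B Q R γ) x.ofLp) :
    ∃ ρ, 0 ≤ ρ ∧ ρ < 1 ∧ ∀ x, √γ * ‖S (optimalLoop A B Q R γ x)‖ ≤ ρ * ‖S x‖ := by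
  obtain ⟨hP, -⟩ := riccatiMatrix_spec hQ hR hγ hAB
  obtain ⟨N, hN, -⟩ := exists_norm_sq_eq_quadForm (inputWeight_posDef B hR hγ hP.posSemidef)
  obtain ⟨S', hS', κ, hκ, hκ'⟩ := exists_norm_sq_eq_quadForm hQ
  -- The cap `1` keeps `1 - ε` nonnegative under the root, and `‖S‖ + 1` avoids dividing by zero.
  let ε : ℝ := min 1 (1 / (κ * (‖S‖ + 1)) ^ 2)
  have hε0 : 0 < ε := by positivity
  have hε1 : ε ≤ 1 := min_le_left _ _
  refine ⟨√(1 - ε), Real.sqrt_nonneg _, ?_, fun x => ?_⟩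
  · rw [Real.sqrt_lt' one_pos]
    linarith
  · have h := stageCost_add_eq hQ hR hγ hAB hS hN x 0
    rw [add_zero, map_zero, map_zero, norm_zero, add_zero, stageCost, inner_toEuclideanLin,
      inner_toEuclideanLin, ← hS'] at h
    have h1 := quadForm_nonneg hR.posSemidef
      (Matrix.toEuclideanLin (optimalGain A B Q R γ) x).ofLp
    have h2 : ε * ‖S x‖ ^ 2 ≤ ‖S' x‖ ^ 2 := by
      have h3 : ‖S x‖ ≤ (κ * (‖S‖ + 1)) * ‖S' x‖ := by
        calc ‖S x‖ ≤ ‖S‖ * ‖x‖ := S.le_opNorm x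
          _ ≤ (‖S‖ + 1) * (κ * ‖S' x‖) := by
              gcongr
              · linarith
              · exact hκ' x
          _ = _ := by ring
      calc ε * ‖S x‖ ^ 2 ≤ 1 / (κ * (‖S‖ + 1)) ^ 2 * ((κ * (‖S‖ + 1)) * ‖S' x‖) ^ 2 := by
            gcongr
            exact min_le_right _ _
        _ = ‖S' x‖ ^ 2 := by field_simp
    refine (sq_le_sq₀ (by positivity) (by positivity)).1 ?_
    rw [mul_pow, mul_pow, Real.sq_sqrt hγ, Real.sq_sqrt (by linarith)]
    simp only [ne_eq, OfNat.ofNat_ne_zero, not_false_eq_true, zero_pow] at h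
    linarith

theorem state_eq_orbit {θ : EuclideanSpace ℝ (Fin d)} (hθ : IsOptimalParam A B Q R f γ θ)
    (φ : EuclideanSpace ℝ (Fin d)) (x : EuclideanSpace ℝ (Fin n)) (t : ℕ) :
    state A B (policy f (θ + φ)) x t =
      orbit (optimalLoop A B Q R γ) (loopPerturbation B f) φ x t := by
  rw [state, orbit]
  congr 1
  funext y
  rw [policy_add, hθ y, map_add, ← add_assoc]
  rfl

variable {ρ₀ : Measure (EuclideanSpace ℝ (Fin n))}

theorem extCost_add_eq (hQ : Q.PosDef) (hR : R.PosDef) (hγ : 0 ≤ γ) (hAB : IsControllable A B)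
    {S : EuclideanSpace ℝ (Fin n) →L[ℝ] EuclideanSpace ℝ (Fin n)}
    (hS : ∀ x, ‖S x‖ ^ 2 = quadForm (riccatiMatrix A B Q R γ) x.ofLp)
    {N : EuclideanSpace ℝ (Fin m) →L[ℝ] EuclideanSpace ℝ (Fin m)}
    (hN : ∀ x, ‖N x‖ ^ 2 = quadForm (inputWeight B R γ (riccatiMatrix A B Q R γ)) x.ofLp)
    {θ φ : EuclideanSpace ℝ (Fin d)} (hθ : IsOptimalParam A B Q R f γ θ) {ρ c β β' δ : ℝ}
    (h : IsStableLoop (fun k x => N (f k x)) (optimalLoop A B Q R γ) (loopPerturbation B f) S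
      (√γ) ρ c β β' δ)
    [IsProbabilityMeasure ρ₀] (hmom : Integrable (fun x => ‖x‖ ^ 2) ρ₀) (hφ : ‖φ‖ ≤ δ) :
    extCost A B Q R f ρ₀ γ (θ + φ) = ∫⁻ x, ENNReal.ofReal (‖S x‖ ^ 2) ∂ρ₀ +
      ENNReal.ofReal (‖outputLp (fun k x => N (f k x)) (optimalLoop A B Q R γ)
        (loopPerturbation B f) (√γ) ρ₀ φ φ‖ ^ 2) := by
  have hmeas : Measurable fun x => ENNReal.ofReal (‖S x‖ ^ 2) := by
    have : Continuous fun x => ‖S x‖ ^ 2 := by fun_prop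
    exact this.measurable.ennreal_ofReal
  rw [h.ofReal_norm_outputLp_sq hmom hφ, ← lintegral_add_left hmeas, extCost]
  refine lintegral_congr fun x => ?_
  simp only [state_eq_orbit hθ]
  set z := orbit (optimalLoop A B Q R γ) (loopPerturbation B f) φ x with hz
  have hpow : ∀ t : ℕ, (√γ ^ t) ^ 2 = γ ^ t := fun t => by
    rw [← pow_mul, mul_comm, pow_mul, Real.sq_sqrt hγ]
  have hout : ∀ t, ‖output (fun k x => N (f k x)) (optimalLoop A B Q R γ) (loopPerturbation B f)
      (√γ) φ φ (x, t)‖ₑ ^ 2 = ENNReal.ofReal (γ ^ t * ‖N (policy f φ (z t))‖ ^ 2) := by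
    intro t
    have e : policy (fun k x => N (f k x)) φ (z t) = N (policy f φ (z t)) :=
      (map_policy f (N : EuclideanSpace ℝ (Fin m) →ₗ[ℝ] EuclideanSpace ℝ (Fin m)) φ (z t)).symm
    change ‖√γ ^ t • policy (fun k x => N (f k x)) φ (z t)‖ₑ ^ 2 = _
    rw [e, ← ofReal_norm, ← ENNReal.ofReal_pow (norm_nonneg _), norm_smul, mul_pow,
      Real.norm_of_nonneg (by positivity), hpow]
  simp only [hout]
  -- The discounted value along the orbit is the square of a geometrically decaying quantity, so no
  -- boundary term survives at infinity.
  have hsum : Summable fun t => γ ^ t * ‖S (z t)‖ ^ 2 := by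
    have hgeo : Summable fun t : ℕ => (β' ^ 2) ^ t * (‖S x‖ + 1) ^ 2 :=
      (summable_geometric_of_lt_one (sq_nonneg _)
        (pow_lt_one₀ h.rate_nonneg h.lt_one two_ne_zero)).mul_right _
    refine hgeo.of_nonneg_of_le (fun t => by positivity) fun t => ?_
    rw [← hpow, ← mul_pow, ← pow_mul, mul_comm 2 t, pow_mul, ← mul_pow]
    refine pow_le_pow_left₀ (by positivity) (le_trans ?_ (h.growth_le hφ x t)) 2
    gcongr
    linarith
  have htel := tsum_ofReal_of_telescoping
    (a := fun t => γ ^ t * stageCost Q R (z t) (policy f (θ + φ) (z t)))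
    (v := fun t => γ ^ t * ‖S (z t)‖ ^ 2) (e := fun t => γ ^ t * ‖N (policy f φ (z t))‖ ^ 2)
    (fun t => mul_nonneg (by positivity) (stageCost_nonneg hQ hR _ _))
    (fun t => by positivity) (fun t => by positivity) (fun t => ?_) hsum
  · rw [htel]
    simp [hz, orbit]
  · have h1 := stageCost_add_eq hQ hR hγ hAB hS hN (z t) (policy f φ (z t))
    have h2 : z (t + 1) = optimalLoop A B Q R γ (z t) +
        Matrix.toEuclideanLin B (policy f φ (z t)) := orbit_succ φ x t
    rw [policy_add, hθ (z t), h2, ← mul_add, ← h1]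
    ring

theorem exists_isStableLoop (hQ : Q.PosDef) (hR : R.PosDef) (hγ0 : 0 ≤ γ) (hγ1 : γ < 1)
    (hAB : IsControllable A B) (hLip : ∀ k, ∃ L, LipschitzWith L (f k))
    {S : EuclideanSpace ℝ (Fin n) →L[ℝ] EuclideanSpace ℝ (Fin n)}
    (hS : ∀ x, ‖S x‖ ^ 2 = quadForm (riccatiMatrix A B Q R γ) x.ofLp)
    {κ : ℝ} (hκ : ∀ x, ‖x‖ ≤ κ * ‖S x‖)
    (N : EuclideanSpace ℝ (Fin m) →L[ℝ] EuclideanSpace ℝ (Fin m)) :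
    ∃ ρ c β β' δ, 0 < δ ∧ δ ≤ 1 ∧ IsStableLoop (fun k x => N (f k x)) (optimalLoop A B Q R γ)
      (loopPerturbation B f) S (√γ) ρ c β β' δ := by
  obtain ⟨ρ, hρ0, hρ1, hρ⟩ := sqrt_mul_norm_optimalLoop_le hQ hR hγ0 hAB hS
  let Bc : EuclideanSpace ℝ (Fin m) →L[ℝ] EuclideanSpace ℝ (Fin n) :=
    (Matrix.toEuclideanLin B).toContinuousLinearMap
  have hlipN : ∀ k, ∃ L, LipschitzWith L fun x => N (f k x) := fun k => by
    obtain ⟨L, hL⟩ := hLip k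
    exact ⟨_, N.lipschitz.comp hL⟩
  have hlipB : ∀ k, ∃ L, LipschitzWith L fun x => S (Bc (f k x)) := fun k => by
    obtain ⟨L, hL⟩ := hLip k
    exact ⟨_, (S.comp Bc).lipschitz.comp hL⟩
  obtain ⟨c₁, h₁⟩ := exists_policyBound hlipN hκ (fun _ => norm_nonneg _)
  obtain ⟨c₂, h₂⟩ := exists_policyBound hlipB hκ (fun _ => norm_nonneg _)
  let c := max 0 (max c₁ c₂)
  have hc : 0 ≤ c := le_max_left _ _
  have hc₁ := h₁ c ((le_max_left _ _).trans (le_max_right _ _))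
  have hc₂ := h₂ c ((le_max_right _ _).trans (le_max_right _ _))
  have hSb : ∀ φ x, S (loopPerturbation B f φ x) = policy (fun k x => S (Bc (f k x))) φ x :=
    fun φ x => map_policy f ((S.comp Bc : EuclideanSpace ℝ (Fin m) →L[ℝ] _) :
      EuclideanSpace ℝ (Fin m) →ₗ[ℝ] EuclideanSpace ℝ (Fin n)) φ x
  have hs1 : √γ < 1 := by rw [Real.sqrt_lt' one_pos]; simpa using hγ1
  obtain ⟨β₀, hρβ, hsβ, hβ₀⟩ : ∃ β₀, ρ ≤ β₀ ∧ √γ ≤ β₀ ∧ β₀ < 1 :=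
    ⟨max ρ (√γ), le_max_left _ _, le_max_right _ _, max_lt hρ1 hs1⟩
  have hpos : 0 < (1 - β₀) / 3 / (c + 1) := by
    have := sub_pos.2 hβ₀
    positivity
  have hcδ : c * min 1 ((1 - β₀) / 3 / (c + 1)) ≤ (1 - β₀) / 3 := by
    calc c * min 1 ((1 - β₀) / 3 / (c + 1)) ≤ (c + 1) * ((1 - β₀) / 3 / (c + 1)) := by
          gcongr
          · linarith
          · exact min_le_right _ _
      _ = _ := by field_simp
  -- The gap between `β₀ = max ρ √γ` and `1` is cut in thirds: one for the perturbation `c δ`, one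
  -- for `β < β'`, one for `β' < 1`.
  refine ⟨ρ, c, (1 + 2 * β₀) / 3, (2 + β₀) / 3, min 1 ((1 - β₀) / 3 / (c + 1)),
    lt_min one_pos hpos, min_le_left _ _, ⟨hρ, fun φ x y => ?_, fun φ x => ?_, fun φ ψ x => ?_⟩,
    hc₁, fun φ => ?_, fun φ => continuous_policy hlipN φ, Real.sqrt_nonneg _, hs1.le, hc,
    (lt_min one_pos hpos).le, by linarith, by linarith, by linarith, by linarith⟩
  · rw [map_sub, hSb, hSb]
    exact hc₂.lip φ x y
  · rw [hSb]
    exact hc₂.growth φ x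
  · rw [map_sub, hSb, hSb, ← policy_sub]
    exact hc₂.growth (φ - ψ) x
  · exact Bc.continuous.comp (continuous_policy hLip φ)

end Cost

end LQR

/-! ### The main theorem. -/

theorem theorem2 {n m d : ℕ}
    (A : Matrix (Fin n) (Fin n) ℝ) (B : Matrix (Fin n) (Fin m) ℝ)
    (Q : Matrix (Fin n) (Fin n) ℝ) (R : Matrix (Fin m) (Fin m) ℝ)
    (hQ : Q.PosDef) (hR : R.PosDef) (hAB : LQR.IsControllable A B)
    (f : Fin d → EuclideanSpace ℝ (Fin n) → EuclideanSpace ℝ (Fin m))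
    (hLip : ∀ k, ∃ L, LipschitzWith L (f k))
    (hind : LinearIndependent ℝ f)
    (hspan : ∀ γ ∈ Set.Icc (0 : ℝ) 1, ∃ θ, LQR.IsOptimalParam A B Q R f γ θ)
    (ρ₀ : MeasureTheory.Measure (EuclideanSpace ℝ (Fin n)))
    [MeasureTheory.IsProbabilityMeasure ρ₀] (hsupp : ρ₀.IsOpenPosMeasure)
    (hmom : MeasureTheory.Integrable (fun x => ‖x‖ ^ 2) ρ₀)
    (γ : ℝ) (hγ : γ ∈ Set.Ioo (0 : ℝ) 1) :
    ∃ θstar : EuclideanSpace ℝ (Fin d),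
      (∀ θ, LQR.IsOptimalParam A B Q R f γ θ ↔ θ = θstar) ∧
      ∃ δ > 0, ∃ lam > 0,
        (∀ θ, ‖θ - θstar‖ < δ → LQR.extCost A B Q R f ρ₀ γ θ ≠ ⊤) ∧
        ∀ θ : ℝ → EuclideanSpace ℝ (Fin d),
          (LQR.IsGradientFlow (LQR.cost A B Q R f ρ₀ γ) θ ∨
            LQR.IsClarkeGradientFlow (LQR.cost A B Q R f ρ₀ γ) θ) →
          ‖θ 0 - θstar‖ < δ →
            (∀ s, 0 ≤ s →
              LQR.extCost A B Q R f ρ₀ γ (θ s) ≠ ⊤ ∧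
              LQR.cost A B Q R f ρ₀ γ (θ s) - LQR.cost A B Q R f ρ₀ γ θstar
                ≤ Real.exp (-(s * lam)) *
                  (LQR.cost A B Q R f ρ₀ γ (θ 0) - LQR.cost A B Q R f ρ₀ γ θstar)) ∧
            Filter.Tendsto θ Filter.atTop (𝓝 θstar) := by
  obtain ⟨θstar, hθ⟩ := hspan γ (Set.Ioo_subset_Icc_self hγ)
  refine ⟨θstar, fun θ => ⟨fun h => (LQR.policy_eq_iff hind).1 fun x => ?_, fun h => h ▸ hθ⟩, ?_⟩
  · rw [h x, hθ x]
  have hγ0 : 0 ≤ γ := hγ.1.le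
  obtain ⟨hP, -⟩ := LQR.riccatiMatrix_spec hQ hR hγ0 hAB
  obtain ⟨S, hS, κ, -, hκ⟩ := LQR.exists_norm_sq_eq_quadForm hP
  obtain ⟨N, hN, κ', -, hκ'⟩ := LQR.exists_norm_sq_eq_quadForm
    (LQR.inputWeight_posDef B hR hγ0 hP.posSemidef)
  obtain ⟨ρ, c, β, β', δ, hδ0, hδ1, hloop⟩ :=
    LQR.exists_isStableLoop (f := f) hQ hR hγ0 hγ.2 hAB hLip hS hκ N
  obtain ⟨K, hK, hb, hlip⟩ := hloop.exists_outputLp_bound hmom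
  set T := LQR.outputLp (fun k x => N (f k x)) (LQR.optimalLoop A B Q R γ)
    (LQR.loopPerturbation B f) (√γ) ρ₀ with hT
  have hext : ∀ φ, ‖φ‖ ≤ δ → LQR.extCost A B Q R f ρ₀ γ (θstar + φ) =
      ∫⁻ x, ENNReal.ofReal (‖S x‖ ^ 2) ∂ρ₀ + ENNReal.ofReal (‖T φ φ‖ ^ 2) := fun φ hφ =>
    LQR.extCost_add_eq hQ hR hγ0 hAB hS hN hθ hloop hmom hφ
  have hfin : ∫⁻ x, ENNReal.ofReal (‖S x‖ ^ 2) ∂ρ₀ ≠ ⊤ := by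
    have h1 : MeasureTheory.Integrable (fun x => ‖S x‖ ^ 2) ρ₀ := by
      refine (hmom.const_mul (‖S‖ ^ 2)).mono' ?_ (Filter.Eventually.of_forall fun x => ?_)
      · have : Continuous fun x => ‖S x‖ ^ 2 := by fun_prop
        exact this.aestronglyMeasurable
      · rw [Real.norm_of_nonneg (by positivity), ← mul_pow]
        exact pow_le_pow_left₀ (norm_nonneg _) (S.le_opNorm x) 2
    exact h1.lintegral_lt_top.ne
  have hcost_fin : ∀ θ, ‖θ - θstar‖ ≤ δ → LQR.extCost A B Q R f ρ₀ γ θ ≠ ⊤ := by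
    intro θ h
    have h1 := hext _ h
    rw [add_sub_cancel] at h1
    rw [h1]
    exact ENNReal.add_ne_top.2 ⟨hfin, ENNReal.ofReal_ne_top⟩
  -- Composing with the injective `N` preserves linear independence of the `f k`.
  have hker : LinearMap.ker (T 0) = ⊥ := by
    have hNker : LinearMap.ker (N : EuclideanSpace ℝ (Fin m) →ₗ[ℝ] EuclideanSpace ℝ (Fin m)) = ⊥ :=
      LinearMap.ker_eq_bot'.2 fun x hx => by
        have h1 := hκ' x
        rw [show N x = 0 from hx, norm_zero, mul_zero] at h1
        exact norm_le_zero_iff.1 h1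
    refine hloop.outputLp_injective hmom ?_ hsupp
    refine hind.map' ((N : EuclideanSpace ℝ (Fin m) →ₗ[ℝ] EuclideanSpace ℝ (Fin m)).compLeft
      (EuclideanSpace ℝ (Fin n))) ?_
    refine LinearMap.ker_eq_bot'.2 fun g hg => ?_
    funext x
    exact LinearMap.ker_eq_bot'.1 hNker _ (congrFun hg x)
  -- In finite dimension injectivity is a quantitative lower bound, which supplies `c = k⁻¹` for the
  -- flow estimate.
  obtain ⟨k, hk, hanti⟩ := LinearMap.exists_antilipschitzWith _ hker
  have hk' : (0 : ℝ) < k := by exact_mod_cast hk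
  have hquad : LQR.IsQuadraticNear (LQR.cost A B Q R f ρ₀ γ) (T 0).toContinuousLinearMap θstar δ
      (10 * K ^ 2) := by
    refine LQR.isQuadraticNear_of_family
      (c₀ := (∫⁻ x, ENNReal.ofReal (‖S x‖ ^ 2) ∂ρ₀).toReal) (T := T) _ (fun _ => rfl)
      hδ1 hK hb hlip fun φ hφ => ?_
    rw [LQR.cost, hext φ hφ, ENNReal.toReal_add hfin ENNReal.ofReal_ne_top,
      ENNReal.toReal_ofReal (by positivity)]
  have hlower : ∀ v, (k : ℝ)⁻¹ * ‖v‖ ≤ ‖(T 0).toContinuousLinearMap v‖ := fun v => by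
    have h1 := hanti.le_mul_dist v 0
    rw [dist_zero_right, map_zero, dist_zero_right] at h1
    rw [inv_mul_le_iff₀ hk']
    exact h1
  obtain ⟨η, hη, hηδ, lam, hlam, hflow⟩ := LQR.exists_forall_flow_exp_decay
    (inv_pos.2 hk') (by positivity) hδ0 hlower hquad
  refine ⟨η, hη, lam, hlam, fun θ h => hcost_fin θ (h.le.trans hηδ), fun θ hθflow h0 => ?_⟩
  obtain ⟨h1, h2⟩ := hflow θ hθflow h0
  exact ⟨fun s hs => ⟨hcost_fin _ ((h1 s hs).1.le.trans hηδ), (h1 s hs).2⟩, h2⟩
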